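/- Let $m\ge 1$, let $D\subset\mathbb{R}^m$ be a bounded domain (a nonempty, bounded, connected open set), let $\mu>0$, and let $u:D\to\mathbb{R}$ be continuous. For $x\in D$ and $r>0$ with $\overline{B_r(x)}\subset D$, where $B_r(x)=\{y:|y-x|<r\}$, put $$M^\circ(u,x,r)=\frac{1}{\omega_m}\int_{S_1(0)}u(x+ry)\,\mathrm{d}S_y,\qquad M^\bullet(u,x,r)=\frac{m}{\omega_m r^m}\int_{B_r(x)}u(y)\,\mathrm{d}y,$$ where $S_1(0)$ is the unit sphere, $\mathrm{d}S$ is the surface area measure (counting measure if $m=1$) and $\omega_m=2\pi^{m/2}/\Gamma(m/2)$ is the total area of the unit sphere. For $t>0$ put $$a^\circ(t)=\Gamma\!\left(\tfrac m2\right)\frac{I_{(m-2)/2}(t)}{(t/2)^{(m-2)/2}},\qquad a^\bullet(t)=\Gamma\!\left(\tfrac m2+1\right)\frac{I_{m/2}(t)}{(t/2)^{m/2}},$$ where $I_\nu(t)=\sum_{k\ge 0}\frac{(t/2)^{2k+\nu}}{k!\,\Gamma(k+\nu+1)}$ is the modified Bessel function of order $\nu$. The function $u$ is called $\mu$-panharmonic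 in $D$ if $u\in C^2(D)$ and $\nabla^2u-\mu^2u=0$ in $D$. (i) Suppose that for every $x\in D$ there is $r(x)>0$ with $\overline{B_{r(x)}(x)}\subset D$ such that $M^\circ(u,x,r)=a^\circ(\mu r)\,u(x)$ for all $r\in(0,r(x))$. Then $u$ is $\mu$-panharmonic in $D$. (ii) Suppose that for every $x\in D$ there is $r(x)>0$ with $\overline{B_{r(x)}(x)}\subset D$ such that $M^\bullet(u,x,r)=a^\bullet(\mu r)\,u(x)$ for all $r\in(0,r(x))$. Then $u$ is $\mu$-panharmonic in $D$. -/

import Mathlib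

open scoped Laplacian
open MeasureTheory

noncomputable section

namespace Panharmonic

/-- A domain in `ℝ^m`: a nonempty, open and connected set. -/
def IsDomainSet {m : ℕ} (D : Set (EuclideanSpace ℝ (Fin m))) : Prop :=
  IsOpen D ∧ IsConnected D

/-- The ball `B_r(x)`, `r > 0`, is admissible with respect to `D`: its closure lies in `D`. -/
def Admissible {m : ℕ} (D : Set (EuclideanSpace ℝ (Fin m))) (x : EuclideanSpace ℝ (Fin m))
    (r : ℝ) : Prop :=
  0 < r ∧ closure (Metric.ball x r) ⊆ D

/-- `u` is `μ`-panharmonic in the open set `D`: it is of class `C²` there and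
`∇²u - μ²u = 0`. -/
def IsPanharmonicOn {m : ℕ} (μ : ℝ) (u : EuclideanSpace ℝ (Fin m) → ℝ)
    (D : Set (EuclideanSpace ℝ (Fin m))) : Prop :=
  ContDiffOn ℝ 2 u D ∧ ∀ x ∈ D, Δ u x - μ ^ 2 * u x = 0

/-- The total area `ω_m = 2 π^{m/2} / Γ(m/2)` of the unit sphere in `ℝ^m`. -/
def unitSphereArea (m : ℕ) : ℝ :=
  2 * Real.pi ^ ((m : ℝ) / 2) / Real.Gamma ((m : ℝ) / 2)

/-- The spherical mean `M°(u, x, r) = ω_m⁻¹ ∫_{S_1(0)} u(x + r y) dS_y`; the surface area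
measure on the unit sphere is the one attached to Lebesgue measure by polar coordinates. -/
def sphericalMean {m : ℕ} (u : EuclideanSpace ℝ (Fin m) → ℝ) (x : EuclideanSpace ℝ (Fin m))
    (r : ℝ) : ℝ :=
  (1 / unitSphereArea m) *
    ∫ y : Metric.sphere (0 : EuclideanSpace ℝ (Fin m)) 1,
      u (x + r • (y : EuclideanSpace ℝ (Fin m)))
        ∂(volume : Measure (EuclideanSpace ℝ (Fin m))).toSphere

/-- The volume mean `M•(u, x, r) = |B_r|⁻¹ ∫_{B_r(x)} u(y) dy`, where `|B_r| = ω_m r^m / m`. -/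
def volumeMean {m : ℕ} (u : EuclideanSpace ℝ (Fin m) → ℝ) (x : EuclideanSpace ℝ (Fin m))
    (r : ℝ) : ℝ :=
  (1 / (unitSphereArea m * r ^ m / m)) * ∫ y in Metric.ball x r, u y

/-- The modified Bessel function `I_ν(z)` of real order `ν` at `z > 0`, by its power series
`∑ (z/2)^{2k+ν} / (k! Γ(k+ν+1))`. -/
def besselI (ν z : ℝ) : ℝ :=
  ∑' k : ℕ, (z / 2) ^ (2 * (k : ℝ) + ν) / ((k.factorial : ℝ) * Real.Gamma ((k : ℝ) + ν + 1))

/-- `a°(t) = Γ(m/2) I_{(m-2)/2}(t) / (t/2)^{(m-2)/2}`, for `t > 0`. -/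
def sphericalCoeff (m : ℕ) (t : ℝ) : ℝ :=
  Real.Gamma ((m : ℝ) / 2) *
    (besselI (((m : ℝ) - 2) / 2) t / (t / 2) ^ (((m : ℝ) - 2) / 2))

/-- `a•(t) = Γ(m/2 + 1) I_{m/2}(t) / (t/2)^{m/2}`, for `t > 0`. -/
def volumeCoeff (m : ℕ) (t : ℝ) : ℝ :=
  Real.Gamma ((m : ℝ) / 2 + 1) * (besselI ((m : ℝ) / 2) t / (t / 2) ^ ((m : ℝ) / 2))

end Panharmonic

end

/-!
The mean value property is assumed at each point `x` only for radii below some `R(x)`, with no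
uniformity in `x`, so mollifying `u` directly is not possible. The argument goes through viscosity
solutions instead.

*Mean values give a viscosity solution.* Both coefficients satisfy `a(μ r) = 1 + μ² c r² / 2 + o(r²)`,
where `c` is the second moment of the coordinates under the normalized measure of the sphere
(`c = 1/m`) or of the ball (`c = 1/(m+2)`). If `g` is of class `C²` at `x` and `u - g` has a local
maximum there, comparing with the second order expansion of the mean of `g` gives
`μ² u(x) ≤ Δ g(x)`; the same holds for `-u` (`IsIsotropic.le_laplacian_of_isLocalMax`).

*Approximation by polynomials.* In a ball, let `p` be a polynomial uniformly close to `u` and let `h`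
be the polynomial with `Δ h = μ² p` that coincides with `p` on the sphere. It exists because
`q ↦ Δ((ρ² - |x - a|²) q)` is injective on polynomials, by the maximum principle, and does not raise
the degree (`exists_polynomial_dirichlet`). The comparison principle shows that `h` is uniformly
close to `u`, and then `Δ h - μ² h` is uniformly small
(`IsViscositySolutionOn.exists_polyFun_near`).

*Regularity.* The function `U(t, x) = u(x) cos(μ t)` is therefore a uniform limit of the functions
`h(x) cos(μ t)`, whose Laplacians `(Δ h - μ² h) cos(μ t)` tend to zero. A limit of this kind
is smooth (`contDiffAt_of_approx`): if `φ` is a radial mollifier and `φ(y) y = ∇g(y)`, integration by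
parts gives `d/ds ∫ W(z - s y) φ(y) dy = -s ∫ ΔW(z - s y) g(y) dy`, so that `U` is a multiple of its
own mollification. Hence `u` is of class `C²`, and taking `g = u` as a test function yields
`Δ u = μ² u`.
-/

namespace Panharmonic

open Set Filter Topology Metric
open scoped Pointwise

/-! ### Second order Taylor expansion -/

/-- Second order Taylor expansion with Peano remainder. -/
theorem taylor_two_isLittleO {E : Type*} [NormedAddCommGroup E] [NormedSpace ℝ E] {g : E → ℝ}
    {x : E} (hg : ContDiffAt ℝ 2 g x) :
    (fun y => g (x + y) - g x - fderiv ℝ g x y - 1 / 2 * fderiv ℝ (fderiv ℝ g) x y y)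
      =o[𝓝 0] fun y => ‖y‖ ^ 2 := by
  have hsymm : ∀ v w, fderiv ℝ (fderiv ℝ g) x v w = fderiv ℝ (fderiv ℝ g) x w v :=
    (hg.isSymmSndFDerivAt (by simp)).eq
  have hd : DifferentiableAt ℝ (fderiv ℝ g) x :=
    (hg.fderiv_right (m := 1) (by norm_num)).differentiableAt (by simp)
  have hdiff : ∀ᶠ y in 𝓝 x, DifferentiableAt ℝ g y := by
    filter_upwards [hg.eventually (by simp)] with y hy using hy.differentiableAt (by simp)
  have ho := hasFDerivAt_iff_isLittleO_nhds_zero.1 hd.hasFDerivAt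
  rw [Asymptotics.isLittleO_iff]
  intro η hη
  have h1 := Asymptotics.isLittleO_iff.1 ho hη
  have h2 : ∀ᶠ y in 𝓝 (0 : E), DifferentiableAt ℝ g (x + y) := by
    have : Tendsto (fun y : E => x + y) (𝓝 0) (𝓝 x) := by
      have := (continuous_const_add x).tendsto (0 : E)
      simpa using this
    exact this.eventually hdiff
  obtain ⟨δ, hδ, hball⟩ := Metric.eventually_nhds_iff_ball.1 (h1.and h2)
  filter_upwards [Metric.ball_mem_nhds (0 : E) hδ] with y hy
  have hy' : ‖y‖ < δ := by simpa using hy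
  have key := (convex_closedBall (0 : E) ‖y‖).norm_image_sub_le_of_norm_hasFDerivWithin_le
    (f := fun y => g (x + y) - g x - fderiv ℝ g x y - 1 / 2 * fderiv ℝ (fderiv ℝ g) x y y)
    (f' := fun y => fderiv ℝ g (x + y) - fderiv ℝ g x - fderiv ℝ (fderiv ℝ g) x y)
    (C := η * ‖y‖) (x := 0) (y := y) ?_ ?_ (by simp) (by simp)
  · simpa [pow_two, mul_assoc] using key
  · intro z hz
    have hz' : z ∈ ball (0 : E) δ := by
      simp only [mem_closedBall, dist_zero_right, mem_ball] at hz ⊢; linarith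
    apply HasFDerivAt.hasFDerivWithinAt
    have hg1 : HasFDerivAt (fun y => g (x + y)) (fderiv ℝ g (x + z)) z :=
      (hball z hz').2.hasFDerivAt.comp z ((hasFDerivAt_id z).const_add x)
    have hB : HasFDerivAt (fun y => fderiv ℝ (fderiv ℝ g) x y y)
        ((fderiv ℝ (fderiv ℝ g) x z) + (fderiv ℝ (fderiv ℝ g) x).flip z) z := by
      exact (fderiv ℝ (fderiv ℝ g) x).hasFDerivAt (x := z) |>.clm_apply (hasFDerivAt_id z)
    have := ((hg1.sub_const (g x)).sub (fderiv ℝ g x).hasFDerivAt).sub (hB.const_mul (1 / 2))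
    refine this.congr_fderiv ?_
    ext w
    simp [hsymm w z]
    ring
  · intro z hz
    have hz' : z ∈ ball (0 : E) δ := by
      simp only [mem_closedBall, dist_zero_right, mem_ball] at hz ⊢; linarith
    refine (hball z hz').1.trans ?_
    simp only [mem_closedBall, dist_zero_right] at hz
    gcongr

/-- The Laplacian as the sum of the pure second partial derivatives. -/
theorem laplacian_eq_sum {E : Type*} [NormedAddCommGroup E] [InnerProductSpace ℝ E]
    [FiniteDimensional ℝ E] {ι : Type*} [Fintype ι] (b : OrthonormalBasis ι ℝ E) (g : E → ℝ)
    (x : E) : Δ g x = ∑ i, fderiv ℝ (fderiv ℝ g) x (b i) (b i) := by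
  rw [InnerProductSpace.laplacian_eq_iteratedFDeriv_orthonormalBasis g b]
  simp [iteratedFDeriv_two_apply]

/-! ### Isotropic probability measures on the unit ball -/

/-- A probability measure carried by the closed unit ball of `ℝ^m` and invariant under all linear
isometries. The constant `c` is the common second moment `∫ y_i² dν` of the coordinates. -/
structure IsIsotropic {m : ℕ} (ν : Measure (EuclideanSpace ℝ (Fin m))) (c : ℝ) : Prop where
  isProbabilityMeasure : IsProbabilityMeasure ν
  ae_norm_le : ∀ᵐ y ∂ν, ‖y‖ ≤ 1
  measurePreserving : ∀ σ : EuclideanSpace ℝ (Fin m) ≃ₗᵢ[ℝ] EuclideanSpace ℝ (Fin m),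
    MeasurePreserving σ ν ν
  integral_norm_sq : ∫ y, ‖y‖ ^ 2 ∂ν = m * c

namespace IsIsotropic

variable {m : ℕ} {ν : Measure (EuclideanSpace ℝ (Fin m))} {c : ℝ}

theorem integral_comp (hν : IsIsotropic ν c)
    (σ : EuclideanSpace ℝ (Fin m) ≃ₗᵢ[ℝ] EuclideanSpace ℝ (Fin m))
    (f : EuclideanSpace ℝ (Fin m) → ℝ) : ∫ y, f (σ y) ∂ν = ∫ y, f y ∂ν :=
  (hν.measurePreserving σ).integral_comp σ.toHomeomorph.measurableEmbedding f

theorem restrict_closedBall (hν : IsIsotropic ν c) : ν.restrict (closedBall 0 1) = ν := by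
  rw [Measure.restrict_eq_self_of_ae_mem]
  simpa using hν.ae_norm_le

theorem integrable_of_continuousOn (hν : IsIsotropic ν c) {f : EuclideanSpace ℝ (Fin m) → ℝ}
    (hf : ContinuousOn f (closedBall 0 1)) : Integrable f ν := by
  have := hν.isProbabilityMeasure
  rw [← hν.restrict_closedBall]
  exact hf.integrableOn_compact (isCompact_closedBall _ _)

theorem integral_clm (hν : IsIsotropic ν c) (L : EuclideanSpace ℝ (Fin m) →L[ℝ] ℝ) :
    ∫ y, L y ∂ν = 0 := by
  have h := hν.integral_comp (LinearIsometryEquiv.neg ℝ) L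
  simp only [LinearIsometryEquiv.coe_neg, map_neg, integral_neg] at h
  linarith

theorem integral_mul_of_ne (hν : IsIsotropic ν c) {i j : Fin m} (hij : i ≠ j) :
    ∫ y, y i * y j ∂ν = 0 := by
  let σ : EuclideanSpace ℝ (Fin m) ≃ₗᵢ[ℝ] EuclideanSpace ℝ (Fin m) :=
    LinearIsometryEquiv.piLpCongrRight 2 fun k =>
      if k = i then LinearIsometryEquiv.neg ℝ else LinearIsometryEquiv.refl ℝ ℝ
  have h := hν.integral_comp σ fun y => y i * y j
  have hσ : ∀ y, σ y i * σ y j = -(y i * y j) := by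
    intro y; simp [σ, hij.symm]
  simp only [hσ, integral_neg] at h
  linarith

theorem integral_mul_self (hν : IsIsotropic ν c) (i : Fin m) : ∫ y, y i * y i ∂ν = c := by
  have hswap : ∀ j, ∫ y, y j * y j ∂ν = ∫ y, y i * y i ∂ν := by
    intro j
    let σ : EuclideanSpace ℝ (Fin m) ≃ₗᵢ[ℝ] EuclideanSpace ℝ (Fin m) :=
      LinearIsometryEquiv.piLpCongrLeft 2 ℝ ℝ (Equiv.swap i j)
    have h := hν.integral_comp σ fun y => y i * y i
    rw [← h]
    simp [σ, LinearIsometryEquiv.piLpCongrLeft_apply, Equiv.piCongrLeft'_apply]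
  have hsum : ∫ y, ‖y‖ ^ 2 ∂ν = ∑ j, ∫ y : EuclideanSpace ℝ (Fin m), y j * y j ∂ν := by
    rw [← integral_finsetSum]
    · congr 1; ext y
      rw [EuclideanSpace.norm_sq_eq]
      simp [pow_two]
    · intro j _
      exact hν.integrable_of_continuousOn (by fun_prop)
  rw [hν.integral_norm_sq, Finset.sum_congr rfl fun j _ => hswap j] at hsum
  have hm : (m : ℝ) ≠ 0 := by
    have := i.pos
    positivity
  simp only [Finset.sum_const, Finset.card_univ, Fintype.card_fin, nsmul_eq_mul] at hsum
  exact (mul_left_cancel₀ hm hsum).symm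

theorem integral_bilin (hν : IsIsotropic ν c)
    (B : EuclideanSpace ℝ (Fin m) →L[ℝ] EuclideanSpace ℝ (Fin m) →L[ℝ] ℝ) :
    ∫ y, B y y ∂ν = c * ∑ i, B (EuclideanSpace.basisFun (Fin m) ℝ i)
      (EuclideanSpace.basisFun (Fin m) ℝ i) := by
  set b := EuclideanSpace.basisFun (Fin m) ℝ with hb
  have hB : ∀ y : EuclideanSpace ℝ (Fin m), B y y = ∑ i, ∑ j, B (b i) (b j) * (y i * y j) := by
    intro y
    conv_lhs => rw [← b.sum_repr y]
    simp only [map_sum, map_smul, sum_apply, smul_apply,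
      smul_eq_mul, Finset.mul_sum]
    rw [Finset.sum_comm]
    simp only [hb, EuclideanSpace.basisFun_repr]
    exact Finset.sum_congr rfl fun i _ => Finset.sum_congr rfl fun j _ => by ring
  have hint : ∀ i j : Fin m, Integrable (fun y => B (b i) (b j) * (y i * y j)) ν := fun i j =>
    hν.integrable_of_continuousOn (by fun_prop)
  rw [integral_congr_ae (ae_of_all _ hB),
    integral_finsetSum _ fun i _ => integrable_finsetSum _ fun j _ => hint i j, Finset.mul_sum]
  refine Finset.sum_congr rfl fun i _ => ?_
  rw [integral_finsetSum _ fun j _ => hint i j, Finset.sum_eq_single i]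
  · rw [integral_const_mul, hν.integral_mul_self, mul_comm]
  · intro j _ hj
    rw [integral_const_mul, hν.integral_mul_of_ne hj.symm, mul_zero]
  · simp

/-- An asymptotic mean value property at `x` forces the second order differential inequality
`κ u(x) ≤ Δ g(x)` for every `C²` function `g` touching `u` from above at `x`: in this sense
`u` is a viscosity subsolution of `Δ u = κ u`. -/
theorem le_laplacian_of_isLocalMax (hν : IsIsotropic ν c) (hc : 0 < c)
    {u g : EuclideanSpace ℝ (Fin m) → ℝ} {x : EuclideanSpace ℝ (Fin m)} {a : ℝ → ℝ} {κ : ℝ}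
    (hu : ∀ᶠ y in 𝓝 x, ContinuousAt u y) (hg : ContDiffAt ℝ 2 g x)
    (ha : Tendsto (fun r => (a r - 1) / r ^ 2) (𝓝[>] 0) (𝓝 (κ * c / 2)))
    (hmean : ∀ᶠ r in 𝓝[>] 0, ∫ y, u (x + r • y) ∂ν = a r * u x)
    (hmax : IsLocalMax (fun y => u y - g y) x) : κ * u x ≤ Δ g x := by
  have := hν.isProbabilityMeasure
  -- it suffices to have the inequality up to an arbitrary error coming from Taylor's formula
  suffices h : ∀ η > 0, κ * c / 2 * u x ≤ c / 2 * Δ g x + η by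
    have h' : κ * c / 2 * u x ≤ c / 2 * Δ g x := le_of_forall_pos_le_add h
    have : c / 2 * (κ * u x) ≤ c / 2 * Δ g x := by linarith
    exact le_of_mul_le_mul_left this (by positivity)
  intro η hη
  have htend : Tendsto (fun r => (a r - 1) / r ^ 2 * u x) (𝓝[>] 0) (𝓝 (κ * c / 2 * u x)) :=
    ha.mul_const _
  refine le_of_tendsto htend ?_
  have htaylor := Asymptotics.isLittleO_iff.1 (taylor_two_isLittleO hg) hη
  have hloc : ∀ᶠ y in 𝓝 (0 : EuclideanSpace ℝ (Fin m)),
      ContinuousAt u (x + y) ∧ u (x + y) - g (x + y) ≤ u x - g x := by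
    have ht : Tendsto (fun y => x + y) (𝓝 (0 : EuclideanSpace ℝ (Fin m))) (𝓝 x) := by
      simpa using (continuous_const_add x).tendsto (0 : EuclideanSpace ℝ (Fin m))
    exact ht.eventually (hu.and hmax)
  obtain ⟨δ, hδ, hball⟩ := Metric.eventually_nhds_iff_ball.1 (htaylor.and hloc)
  filter_upwards [hmean, self_mem_nhdsWithin,
    mem_nhdsWithin_of_mem_nhds (Iio_mem_nhds hδ)] with r hr hr0 hrδ
  simp only [mem_Ioi, mem_Iio] at hr0 hrδ
  have hin : ∀ y ∈ closedBall (0 : EuclideanSpace ℝ (Fin m)) 1, r • y ∈ ball 0 δ := by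
    intro y hy
    simp only [mem_closedBall, dist_zero_right, mem_ball] at hy ⊢
    rw [norm_smul, Real.norm_of_nonneg hr0.le]
    nlinarith [norm_nonneg y]
  have hui : Integrable (fun y => u (x + r • y)) ν := by
    refine hν.integrable_of_continuousOn fun y hy => ?_
    have h1 : ContinuousAt (fun y => x + r • y) y := by fun_prop
    exact (ContinuousAt.comp (f := fun y => x + r • y) (hball _ (hin y hy)).2.1
      h1).continuousWithinAt
  have hpi : ∀ f : EuclideanSpace ℝ (Fin m) → ℝ, Continuous f → Integrable f ν :=
    fun f hf => hν.integrable_of_continuousOn hf.continuousOn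
  set L := fderiv ℝ g x
  set B := fderiv ℝ (fderiv ℝ g) x
  have hle : ∫ y, u (x + r • y) ∂ν ≤
      ∫ y, (u x + η * r ^ 2 + r * L y + r ^ 2 / 2 * B y y) ∂ν := by
    refine integral_mono_ae hui (hpi _ (by fun_prop)) ?_
    filter_upwards [hν.ae_norm_le] with y hy
    obtain ⟨h1, -, h3⟩ := hball _ (hin y (by simpa using hy))
    have hnorm : ‖r • y‖ = r * ‖y‖ := by rw [norm_smul, Real.norm_of_nonneg hr0.le]
    rw [Real.norm_of_nonneg (by positivity : 0 ≤ ‖r • y‖ ^ 2), hnorm] at h1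
    have h4 := (abs_le.1 h1).2
    simp only [map_smul, smul_apply, smul_eq_mul] at h4
    have h5 : η * (r * ‖y‖) ^ 2 ≤ η * r ^ 2 := by
      have : r * ‖y‖ ≤ r := by nlinarith [norm_nonneg y]
      gcongr
    show u (x + r • y) ≤ u x + η * r ^ 2 + r * L y + r ^ 2 / 2 * B y y
    nlinarith
  rw [integral_add (hpi _ (by fun_prop)) (hpi _ (by fun_prop)),
    integral_add (hpi _ (by fun_prop)) (hpi _ (by fun_prop)), integral_const_mul,
    integral_const_mul, hν.integral_clm, hν.integral_bilin, hr, ← laplacian_eq_sum] at hle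
  simp only [integral_const, probReal_univ, one_smul, mul_zero, add_zero] at hle
  rw [div_mul_eq_mul_div, div_le_iff₀ (by positivity)]
  nlinarith

end IsIsotropic

/-! ### The two means as integrals against isotropic measures -/

theorem volume_real_ball_zero_one {m : ℕ} (hm : 1 ≤ m) :
    volume.real (ball (0 : EuclideanSpace ℝ (Fin m)) 1) = unitSphereArea m / m := by
  have : Nonempty (Fin m) := ⟨⟨0, hm⟩⟩
  have hm0 : (0 : ℝ) < m := by exact_mod_cast hm
  have hpi : √Real.pi ^ m = Real.pi ^ ((m : ℝ) / 2) := by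
    rw [Real.sqrt_eq_rpow, ← Real.rpow_natCast, ← Real.rpow_mul Real.pi_pos.le]
    congr 1; ring
  have hΓ : 0 < Real.Gamma ((m : ℝ) / 2) := Real.Gamma_pos_of_pos (by positivity)
  rw [measureReal_def, EuclideanSpace.volume_ball, Fintype.card_fin,
    Real.Gamma_add_one (by positivity), hpi, unitSphereArea]
  simp only [ENNReal.ofReal_one, one_pow, one_mul]
  rw [ENNReal.toReal_ofReal (by positivity)]
  field_simp

theorem unitSphereArea_pos {m : ℕ} (hm : 1 ≤ m) : 0 < unitSphereArea m := by
  have hm0 : (0 : ℝ) < m := by exact_mod_cast hm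
  have hΓ : 0 < Real.Gamma ((m : ℝ) / 2) := Real.Gamma_pos_of_pos (by positivity)
  have := Real.pi_pos
  unfold unitSphereArea
  positivity

/-- The normalized surface measure of the unit sphere, as a measure on `ℝ^m`. -/
noncomputable def sphereMeasure (m : ℕ) : Measure (EuclideanSpace ℝ (Fin m)) :=
  ENNReal.ofReal (1 / unitSphereArea m) •
    (volume : Measure (EuclideanSpace ℝ (Fin m))).toSphere.map (↑)

/-- The normalized Lebesgue measure of the unit ball. -/
noncomputable def ballMeasure (m : ℕ) : Measure (EuclideanSpace ℝ (Fin m)) :=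
  ENNReal.ofReal (1 / (unitSphereArea m / m)) • volume.restrict (ball 0 1)

theorem measurableEmbedding_sphere_val (m : ℕ) :
    MeasurableEmbedding ((↑) : sphere (0 : EuclideanSpace ℝ (Fin m)) 1 →
      EuclideanSpace ℝ (Fin m)) :=
  MeasurableEmbedding.subtype_coe isClosed_sphere.measurableSet

theorem integral_sphereMeasure {m : ℕ} (hm : 1 ≤ m) (f : EuclideanSpace ℝ (Fin m) → ℝ) :
    ∫ y, f y ∂sphereMeasure m = 1 / unitSphereArea m *
      ∫ y : sphere (0 : EuclideanSpace ℝ (Fin m)) 1, f y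
        ∂(volume : Measure (EuclideanSpace ℝ (Fin m))).toSphere := by
  rw [sphereMeasure, integral_smul_measure, (measurableEmbedding_sphere_val m).integral_map,
    ENNReal.toReal_ofReal (one_div_pos.2 (unitSphereArea_pos hm)).le, smul_eq_mul]

theorem integral_ballMeasure {m : ℕ} (hm : 1 ≤ m) (f : EuclideanSpace ℝ (Fin m) → ℝ) :
    ∫ y, f y ∂ballMeasure m = 1 / (unitSphereArea m / m) * ∫ y in ball 0 1, f y := by
  have := unitSphereArea_pos hm
  rw [ballMeasure, integral_smul_measure, ENNReal.toReal_ofReal (by positivity), smul_eq_mul]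

theorem sphericalMean_eq_integral {m : ℕ} (hm : 1 ≤ m) (u : EuclideanSpace ℝ (Fin m) → ℝ)
    (x : EuclideanSpace ℝ (Fin m)) (r : ℝ) :
    sphericalMean u x r = ∫ y, u (x + r • y) ∂sphereMeasure m := by
  rw [integral_sphereMeasure hm, sphericalMean]

theorem volumeMean_eq_integral {m : ℕ} (hm : 1 ≤ m) (u : EuclideanSpace ℝ (Fin m) → ℝ)
    (x : EuclideanSpace ℝ (Fin m)) {r : ℝ} (hr : 0 < r) :
    volumeMean u x r = ∫ y, u (x + r • y) ∂ballMeasure m := by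
  have := unitSphereArea_pos hm
  have hm0 : (0 : ℝ) < m := by exact_mod_cast hm
  rw [integral_ballMeasure hm, volumeMean,
    Measure.setIntegral_comp_smul volume (fun z => u (x + z)) (ball 0 1) hr.ne',
    smul_unitBall hr.ne', Real.norm_of_nonneg hr.le, finrank_euclideanSpace_fin,
    abs_of_pos (by positivity), smul_eq_mul]
  have hshift : ∫ z in ball (0 : EuclideanSpace ℝ (Fin m)) r, u (x + z) = ∫ z in ball x r, u z := by
    have h := (measurePreserving_add_left (volume : Measure (EuclideanSpace ℝ (Fin m))) x)
      |>.setIntegral_preimage_emb (MeasurableEquiv.addLeft x).measurableEmbedding u (ball x r)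
    simpa using h
  rw [hshift]
  field_simp

theorem Ioo_smul_sphere_inter_preimage {m : ℕ}
    (σ : EuclideanSpace ℝ (Fin m) ≃ₗᵢ[ℝ] EuclideanSpace ℝ (Fin m))
    (s : Set (EuclideanSpace ℝ (Fin m))) :
    Ioo (0 : ℝ) 1 • (sphere 0 1 ∩ σ ⁻¹' s) = σ ⁻¹' (Ioo (0 : ℝ) 1 • (sphere 0 1 ∩ s)) := by
  ext z
  simp only [Set.mem_smul, mem_inter_iff, mem_preimage, mem_sphere_zero_iff_norm]
  constructor
  · rintro ⟨t, ht, y, ⟨hy, hys⟩, rfl⟩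
    exact ⟨t, ht, σ y, ⟨by simpa using hy, hys⟩, by simp⟩
  · rintro ⟨t, ht, y, ⟨hy, hys⟩, h⟩
    exact ⟨t, ht, σ.symm y, ⟨by simpa using hy, by simpa using hys⟩, by
      apply σ.injective; simpa using h⟩

theorem isIsotropic_sphereMeasure {m : ℕ} (hm : 1 ≤ m) :
    IsIsotropic (sphereMeasure m) (1 / m) := by
  have hω := unitSphereArea_pos hm
  have hm0 : (0 : ℝ) < m := by exact_mod_cast hm
  have hemb := measurableEmbedding_sphere_val m
  have htotal : (volume : Measure (EuclideanSpace ℝ (Fin m))).toSphere.real univ =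
      unitSphereArea m := by
    rw [Measure.toSphere_real_apply_univ, volume_real_ball_zero_one hm,
      finrank_euclideanSpace_fin]
    field_simp
  refine ⟨⟨?_⟩, ?_, fun σ => ⟨σ.continuous.measurable, ?_⟩, ?_⟩
  · rw [sphereMeasure, Measure.smul_apply, hemb.map_apply, preimage_univ, smul_eq_mul,
      ← ofReal_measureReal, htotal, ← ENNReal.ofReal_mul (by positivity),
      one_div_mul_cancel hω.ne', ENNReal.ofReal_one]
  · refine Measure.ae_smul_measure ?_ _
    rw [hemb.ae_map_iff]
    exact ae_of_all _ fun y => by simp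
  · rw [sphereMeasure, Measure.map_smul]
    congr 1
    ext s hs
    have hs' : MeasurableSet (σ ⁻¹' s) := σ.continuous.measurable hs
    rw [Measure.map_apply σ.continuous.measurable hs, hemb.map_apply, hemb.map_apply,
      Measure.toSphere_apply' _ (hemb.measurable hs'), Measure.toSphere_apply' _ (hemb.measurable hs),
      Subtype.image_preimage_coe, Subtype.image_preimage_coe, Ioo_smul_sphere_inter_preimage,
      σ.measurePreserving.measure_preimage_emb σ.toHomeomorph.measurableEmbedding]
  · rw [integral_sphereMeasure hm]
    simp only [norm_eq_of_mem_sphere, one_pow, integral_const, htotal, smul_eq_mul, mul_one]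
    field_simp

theorem setIntegral_ball_norm_sq {m : ℕ} (hm : 1 ≤ m) :
    ∫ y in ball (0 : EuclideanSpace ℝ (Fin m)) 1, ‖y‖ ^ 2 = unitSphereArea m / (m + 2) := by
  have : Nontrivial (EuclideanSpace ℝ (Fin m)) := by
    have : Nonempty (Fin m) := ⟨⟨0, hm⟩⟩
    infer_instance
  have hm0 : (0 : ℝ) < m := by exact_mod_cast hm
  have h := integral_fun_norm_addHaar (volume : Measure (EuclideanSpace ℝ (Fin m)))
    ((Iio (1 : ℝ)).indicator fun t => t ^ 2)
  have h1 : (fun y : EuclideanSpace ℝ (Fin m) => (Iio (1 : ℝ)).indicator (fun t => t ^ 2) ‖y‖) =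
      (ball 0 1).indicator fun y => ‖y‖ ^ 2 := by
    ext y; simp [indicator]
  have h2 : (fun t : ℝ => t ^ (m - 1) • (Iio (1 : ℝ)).indicator (fun t => t ^ 2) t) =
      (Iio (1 : ℝ)).indicator fun t => t ^ (m + 1) := by
    ext t
    by_cases ht : t < 1
    · simp only [mem_Iio, ht, indicator_of_mem, smul_eq_mul, ← pow_add]
      congr 1; omega
    · simp [ht]
  rw [h1, integral_indicator measurableSet_ball, finrank_euclideanSpace_fin, h2,
    setIntegral_indicator measurableSet_Iio, Ioi_inter_Iio, ← integral_Ioc_eq_integral_Ioo,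
    ← intervalIntegral.integral_of_le zero_le_one, integral_pow,
    volume_real_ball_zero_one hm] at h
  rw [h]
  simp only [nsmul_eq_mul, smul_eq_mul, one_pow]
  push_cast
  rw [zero_pow (by omega)]
  field_simp
  ring

theorem isIsotropic_ballMeasure {m : ℕ} (hm : 1 ≤ m) :
    IsIsotropic (ballMeasure m) (1 / (m + 2)) := by
  have hω := unitSphereArea_pos hm
  have hm0 : (0 : ℝ) < m := by exact_mod_cast hm
  refine ⟨⟨?_⟩, ?_, fun σ => ?_, ?_⟩
  · rw [ballMeasure, Measure.smul_apply, Measure.restrict_apply_univ, smul_eq_mul,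
      ← ofReal_measureReal (by simp [measure_ball_lt_top.ne]), volume_real_ball_zero_one hm,
      ← ENNReal.ofReal_mul (by positivity), one_div_mul_cancel (by positivity),
      ENNReal.ofReal_one]
  · refine Measure.ae_smul_measure ?_ _
    filter_upwards [ae_restrict_mem measurableSet_ball] with y hy
    simpa using (mem_ball.1 hy).le
  · have h := σ.measurePreserving.restrict_preimage (measurableSet_ball (x := 0) (ε := 1))
    rw [σ.preimage_ball] at h
    simp only [map_zero] at h
    exact h.smul_measure _
  · rw [integral_ballMeasure hm, setIntegral_ball_norm_sq hm]
    field_simp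

/-! ### Small-radius behaviour of the Bessel coefficients -/

theorem Gamma_half_le {s : ℝ} (hs : 1 / 2 ≤ s) (k : ℕ) :
    Real.Gamma s / 2 ≤ Real.Gamma (k + s) := by
  have hΓ : 0 < Real.Gamma s := Real.Gamma_pos_of_pos (by linarith)
  rcases k with _ | k
  · simp; linarith
  · induction k with
    | zero =>
      have : Real.Gamma (((0 + 1 : ℕ) : ℝ) + s) = s * Real.Gamma s := by
        rw [← Real.Gamma_add_one (by linarith)]; congr 1; push_cast; ring
      rw [this]; nlinarith
    | succ k ih =>
      have hk : (0 : ℝ) ≤ k := k.cast_nonneg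
      have : Real.Gamma (((k + 1 + 1 : ℕ) : ℝ) + s) =
          (((k + 1 : ℕ) : ℝ) + s) * Real.Gamma (((k + 1 : ℕ) : ℝ) + s) := by
        rw [← Real.Gamma_add_one (by push_cast; linarith)]; congr 1; push_cast; ring
      rw [this]
      refine ih.trans (le_mul_of_one_le_left (by linarith) ?_)
      push_cast; linarith

/-- The Taylor coefficients of the entire function `Γ(s) I_{s-1}(2√z) / z^{(s-1)/2}`. -/
noncomputable def besselCoeff (s : ℝ) (k : ℕ) : ℝ :=
  Real.Gamma s / ((k.factorial : ℝ) * Real.Gamma (k + s))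

theorem besselCoeff_nonneg {s : ℝ} (hs : 1 / 2 ≤ s) (k : ℕ) : 0 ≤ besselCoeff s k := by
  have h1 : 0 < Real.Gamma s := Real.Gamma_pos_of_pos (by linarith)
  have h2 : 0 < Real.Gamma (k + s) := Real.Gamma_pos_of_pos (by positivity)
  unfold besselCoeff
  positivity

theorem besselCoeff_le {s : ℝ} (hs : 1 / 2 ≤ s) (k : ℕ) :
    besselCoeff s k ≤ 2 * (1 / (k.factorial : ℝ)) := by
  have h1 : 0 < Real.Gamma s := Real.Gamma_pos_of_pos (by linarith)
  have h2 : 0 < Real.Gamma (k + s) := Real.Gamma_pos_of_pos (by positivity)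
  have h3 := Gamma_half_le hs k
  have h4 : (0 : ℝ) < k.factorial := by exact_mod_cast k.factorial_pos
  rw [besselCoeff, div_le_iff₀ (by positivity)]
  field_simp
  linarith

theorem Gamma_mul_besselI {s t : ℝ} (ht : 0 < t) :
    Real.Gamma s * (besselI (s - 1) t / (t / 2) ^ (s - 1)) =
      ∑' k, besselCoeff s k * ((t / 2) ^ 2) ^ k := by
  rw [besselI, ← tsum_div_const, ← tsum_mul_left]
  congr 1
  ext k
  have ht2 : 0 < t / 2 := by positivity
  have h0 : (t / 2) ^ (s - 1) ≠ 0 := (Real.rpow_pos_of_pos ht2 _).ne'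
  have h1 : (2 : ℝ) * (k : ℝ) = ((2 * k : ℕ) : ℝ) := by push_cast; ring
  rw [Real.rpow_add ht2, h1, Real.rpow_natCast, pow_mul, besselCoeff,
    show (k : ℝ) + (s - 1) + 1 = k + s by ring]
  field_simp

theorem tendsto_besselCoeff_tsum {s : ℝ} (hs : 1 / 2 ≤ s) :
    Tendsto (fun t => ((∑' k, besselCoeff s k * ((t / 2) ^ 2) ^ k) - 1) / t ^ 2) (𝓝[>] 0)
      (𝓝 (1 / (4 * s))) := by
  have hΓ : 0 < Real.Gamma s := Real.Gamma_pos_of_pos (by linarith)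
  have hfact : Summable fun k : ℕ => 2 * (1 / (k.factorial : ℝ)) := by
    have := Real.summable_pow_div_factorial 1
    simpa using this.mul_left 2
  have hbound : ∀ k : ℕ, ∀ z ∈ Icc (0 : ℝ) 1,
      ‖besselCoeff s k * z ^ k‖ ≤ 2 * (1 / (k.factorial : ℝ)) := by
    intro k z hz
    rw [Real.norm_of_nonneg (mul_nonneg (besselCoeff_nonneg hs k) (pow_nonneg hz.1 k))]
    exact (mul_le_of_le_one_right (besselCoeff_nonneg hs k) (pow_le_one₀ hz.1 hz.2)).trans
      (besselCoeff_le hs k)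
  have hbound' : ∀ k : ℕ, ∀ z ∈ Icc (0 : ℝ) 1,
      ‖besselCoeff s (k + 1) * z ^ k‖ ≤ 2 * (1 / ((k + 1).factorial : ℝ)) := by
    intro k z hz
    rw [Real.norm_of_nonneg (mul_nonneg (besselCoeff_nonneg hs _) (pow_nonneg hz.1 k))]
    exact (mul_le_of_le_one_right (besselCoeff_nonneg hs _) (pow_le_one₀ hz.1 hz.2)).trans
      (besselCoeff_le hs _)
  have hcont : ContinuousOn (fun z : ℝ => ∑' k, besselCoeff s (k + 1) * z ^ k) (Icc 0 1) :=
    continuousOn_tsum (fun k => by fun_prop) ((summable_nat_add_iff 1).2 hfact) hbound'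
  have h0 : ∑' k, besselCoeff s (k + 1) * (0 : ℝ) ^ k = 1 / s := by
    rw [tsum_eq_single 0 fun k hk => by simp [hk]]
    have hs0 : s ≠ 0 := by linarith
    have : Real.Gamma (((0 + 1 : ℕ) : ℝ) + s) = s * Real.Gamma s := by
      rw [← Real.Gamma_add_one hs0]; congr 1; push_cast; ring
    rw [besselCoeff, this]
    simp only [zero_add, Nat.factorial_one, Nat.cast_one, pow_zero]
    field_simp
  have htend : Tendsto (fun t : ℝ => (t / 2) ^ 2) (𝓝[>] 0) (𝓝[Icc 0 1] 0) := by
    refine tendsto_nhdsWithin_iff.2 ⟨?_, ?_⟩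
    · have : Continuous fun t : ℝ => (t / 2) ^ 2 := by fun_prop
      simpa using (this.tendsto 0).mono_left nhdsWithin_le_nhds
    · filter_upwards [self_mem_nhdsWithin, mem_nhdsWithin_of_mem_nhds (Iio_mem_nhds two_pos)]
        with t ht0 ht2
      simp only [mem_Ioi, mem_Iio] at ht0 ht2
      exact ⟨by positivity, by nlinarith⟩
  have hlim := ((hcont 0 (by simp)).tendsto.comp htend).div_const 4
  rw [h0, div_div, mul_comm s 4] at hlim
  refine hlim.congr' ?_
  filter_upwards [self_mem_nhdsWithin, htend.eventually self_mem_nhdsWithin] with t ht0 ht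
  simp only [mem_Ioi] at ht0
  have hsum : Summable fun k => besselCoeff s k * ((t / 2) ^ 2) ^ k :=
    Summable.of_norm_bounded hfact fun k => hbound k _ ht
  have hc0 : besselCoeff s 0 = 1 := by simp [besselCoeff, hΓ.ne']
  rw [hsum.tsum_eq_zero_add, hc0]
  have hshift : ∀ k, besselCoeff s (k + 1) * ((t / 2) ^ 2) ^ (k + 1) =
      besselCoeff s (k + 1) * ((t / 2) ^ 2) ^ k * (t / 2) ^ 2 := fun k => by ring
  simp only [Function.comp_apply, pow_zero, mul_one, add_sub_cancel_left, hshift, tsum_mul_right]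
  generalize ∑' k, besselCoeff s (k + 1) * ((t / 2) ^ 2) ^ k = T
  field_simp
  norm_num

theorem tendsto_sub_one_div_sq {s μ : ℝ} (hs : 1 / 2 ≤ s) (hμ : 0 < μ) {a : ℝ → ℝ}
    (ha : ∀ t, 0 < t → a t = Real.Gamma s * (besselI (s - 1) t / (t / 2) ^ (s - 1))) :
    Tendsto (fun r => (a (μ * r) - 1) / r ^ 2) (𝓝[>] 0) (𝓝 (μ ^ 2 * (1 / (4 * s)))) := by
  have hmul : Tendsto (fun r => μ * r) (𝓝[>] 0) (𝓝[>] 0) := by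
    refine tendsto_nhdsWithin_iff.2 ⟨?_, ?_⟩
    · simpa using ((continuous_const_mul μ).tendsto 0).mono_left nhdsWithin_le_nhds
    · filter_upwards [self_mem_nhdsWithin] with r hr using mul_pos hμ hr
  refine (((tendsto_besselCoeff_tsum hs).comp hmul).const_mul (μ ^ 2)).congr' ?_
  filter_upwards [self_mem_nhdsWithin] with r hr
  have hr0 : 0 < r := hr
  rw [ha _ (mul_pos hμ hr0), Gamma_mul_besselI (mul_pos hμ hr0)]
  simp only [Function.comp_apply]
  field_simp

/-! ### Viscosity solutions -/

/-- `u` is a viscosity subsolution of `Δ u = κ u` in `D`: whenever `u - g` has a local maximum at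
a point of `D` at which `g` is of class `C²`, the inequality `κ u ≤ Δ g` holds at that point. -/
def IsViscositySubsolutionOn {m : ℕ} (κ : ℝ) (u : EuclideanSpace ℝ (Fin m) → ℝ)
    (D : Set (EuclideanSpace ℝ (Fin m))) : Prop :=
  ∀ x ∈ D, ∀ g : EuclideanSpace ℝ (Fin m) → ℝ, ContDiffAt ℝ 2 g x →
    IsLocalMax (fun y => u y - g y) x → κ * u x ≤ Δ g x

/-- `u` is a viscosity solution of `Δ u = κ u` in `D`: both `u` and `-u` are viscosity
subsolutions. -/
def IsViscositySolutionOn {m : ℕ} (κ : ℝ) (u : EuclideanSpace ℝ (Fin m) → ℝ)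
    (D : Set (EuclideanSpace ℝ (Fin m))) : Prop :=
  IsViscositySubsolutionOn κ u D ∧ IsViscositySubsolutionOn κ (-u) D

theorem IsIsotropic.isViscositySolutionOn {m : ℕ} {ν : Measure (EuclideanSpace ℝ (Fin m))} {c : ℝ}
    (hν : IsIsotropic ν c) (hc : 0 < c) {D : Set (EuclideanSpace ℝ (Fin m))} (hD : IsOpen D)
    {u : EuclideanSpace ℝ (Fin m) → ℝ} (hu : ContinuousOn u D) {a : ℝ → ℝ} {κ : ℝ}
    (ha : Tendsto (fun r => (a r - 1) / r ^ 2) (𝓝[>] 0) (𝓝 (κ * c / 2)))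
    (hmean : ∀ x ∈ D, ∀ᶠ r in 𝓝[>] 0, ∫ y, u (x + r • y) ∂ν = a r * u x) :
    IsViscositySolutionOn κ u D := by
  have hcont : ∀ x ∈ D, ∀ᶠ y in 𝓝 x, ContinuousAt u y := fun x hx => by
    filter_upwards [hD.mem_nhds hx] with y hy using hu.continuousAt (hD.mem_nhds hy)
  refine ⟨fun x hx g hg hmax => ?_, fun x hx g hg hmax => ?_⟩
  · exact hν.le_laplacian_of_isLocalMax hc (hcont x hx) hg ha (hmean x hx) hmax
  · refine hν.le_laplacian_of_isLocalMax hc ?_ hg ha ?_ hmax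
    · filter_upwards [hcont x hx] with y hy using hy.neg
    · filter_upwards [hmean x hx] with r hr
      simp only [Pi.neg_apply, integral_neg, hr, mul_neg]

theorem isViscositySolutionOn_of_sphericalMean {m : ℕ} (hm : 1 ≤ m)
    {D : Set (EuclideanSpace ℝ (Fin m))} (hD : IsOpen D) {μ : ℝ} (hμ : 0 < μ)
    {u : EuclideanSpace ℝ (Fin m) → ℝ} (hu : ContinuousOn u D)
    (hmean : ∀ x ∈ D, ∃ R : ℝ, Admissible D x R ∧ ∀ r ∈ Ioo 0 R,
      sphericalMean u x r = sphericalCoeff m (μ * r) * u x) :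
    IsViscositySolutionOn (μ ^ 2) u D := by
  have hm1 : (1 : ℝ) ≤ m := by exact_mod_cast hm
  refine (isIsotropic_sphereMeasure hm).isViscositySolutionOn (by positivity) hD hu
    (a := fun r => sphericalCoeff m (μ * r)) ?_ fun x hx => ?_
  · have h := tendsto_sub_one_div_sq (s := (m : ℝ) / 2) (by linarith) hμ
      (a := sphericalCoeff m) fun t _ => by
        rw [sphericalCoeff, show ((m : ℝ) - 2) / 2 = (m : ℝ) / 2 - 1 by ring]
    convert h using 2
    field_simp
    norm_num
  · obtain ⟨R, hR, h⟩ := hmean x hx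
    filter_upwards [Ioo_mem_nhdsGT hR.1] with r hr
    rw [← sphericalMean_eq_integral hm, h r hr]

theorem isViscositySolutionOn_of_volumeMean {m : ℕ} (hm : 1 ≤ m)
    {D : Set (EuclideanSpace ℝ (Fin m))} (hD : IsOpen D) {μ : ℝ} (hμ : 0 < μ)
    {u : EuclideanSpace ℝ (Fin m) → ℝ} (hu : ContinuousOn u D)
    (hmean : ∀ x ∈ D, ∃ R : ℝ, Admissible D x R ∧ ∀ r ∈ Ioo 0 R,
      volumeMean u x r = volumeCoeff m (μ * r) * u x) :
    IsViscositySolutionOn (μ ^ 2) u D := by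
  have hm1 : (1 : ℝ) ≤ m := by exact_mod_cast hm
  refine (isIsotropic_ballMeasure hm).isViscositySolutionOn (by positivity) hD hu
    (a := fun r => volumeCoeff m (μ * r)) ?_ fun x hx => ?_
  · have h := tendsto_sub_one_div_sq (s := (m : ℝ) / 2 + 1) (by linarith) hμ
      (a := volumeCoeff m) fun t _ => by
        rw [volumeCoeff, show (m : ℝ) / 2 + 1 - 1 = (m : ℝ) / 2 by ring]
    convert h using 2
    field_simp
    ring
  · obtain ⟨R, hR, h⟩ := hmean x hx
    filter_upwards [Ioo_mem_nhdsGT hR.1] with r hr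
    rw [← volumeMean_eq_integral hm u x hr.1, h r hr]

/-! ### Polynomial functions and their Laplacians -/

/-- The function on `ℝ^m` defined by a polynomial in `m` variables. -/
noncomputable def polyFun {m : ℕ} (p : MvPolynomial (Fin m) ℝ) (x : EuclideanSpace ℝ (Fin m)) : ℝ :=
  MvPolynomial.eval x.ofLp p

/-- The Laplacian as a linear endomorphism of the polynomial ring. -/
noncomputable def polyLaplacian (m : ℕ) : MvPolynomial (Fin m) ℝ →ₗ[ℝ] MvPolynomial (Fin m) ℝ :=
  ∑ i, ((MvPolynomial.pderiv i).toLinearMap ∘ₗ (MvPolynomial.pderiv i).toLinearMap)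

theorem polyLaplacian_apply {m : ℕ} (p : MvPolynomial (Fin m) ℝ) :
    polyLaplacian m p = ∑ i, MvPolynomial.pderiv i (MvPolynomial.pderiv i p) := by
  simp [polyLaplacian]

theorem contDiff_polyFun {m : ℕ} (p : MvPolynomial (Fin m) ℝ) {n : WithTop ℕ∞} :
    ContDiff ℝ n (polyFun p) := by
  induction p using MvPolynomial.induction_on with
  | C a =>
    have : polyFun (m := m) (MvPolynomial.C a) = fun _ => a := by ext; simp [polyFun]
    rw [this]
    exact contDiff_const
  | add p q hp hq =>
    have : polyFun (p + q) = fun y => polyFun p y + polyFun q y := by ext; simp [polyFun]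
    rw [this]
    exact hp.add hq
  | mul_X p i hp =>
    have : polyFun (p * MvPolynomial.X i) = fun y => polyFun p y * y i := by ext; simp [polyFun]
    rw [this]
    exact hp.mul (contDiff_euclidean.1 contDiff_id i)

theorem fderiv_polyFun {m : ℕ} (p : MvPolynomial (Fin m) ℝ) (i : Fin m)
    (x : EuclideanSpace ℝ (Fin m)) :
    fderiv ℝ (polyFun p) x (EuclideanSpace.basisFun (Fin m) ℝ i) =
      polyFun (MvPolynomial.pderiv i p) x := by
  induction p using MvPolynomial.induction_on with
  | C a =>
    have : polyFun (m := m) (MvPolynomial.C a) = fun _ => a := by ext; simp [polyFun]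
    rw [this]
    simp [polyFun]
  | add p q hp hq =>
    have hpd := (contDiff_polyFun p (n := 1)).differentiable one_ne_zero x
    have hqd := (contDiff_polyFun q (n := 1)).differentiable one_ne_zero x
    have : polyFun (p + q) = fun y => polyFun p y + polyFun q y := by ext; simp [polyFun]
    rw [this, fderiv_fun_add hpd hqd, add_apply, hp, hq]
    simp [polyFun]
  | mul_X p j hp =>
    have hpd := (contDiff_polyFun p (n := 1)).differentiable one_ne_zero x
    have hX := (EuclideanSpace.proj j : EuclideanSpace ℝ (Fin m) →L[ℝ] ℝ).hasFDerivAt (x := x)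
    have : polyFun (p * MvPolynomial.X j) =
        polyFun p * ⇑(EuclideanSpace.proj j : EuclideanSpace ℝ (Fin m) →L[ℝ] ℝ) := by
      ext; simp [polyFun]
    rw [this, (hpd.hasFDerivAt.mul hX).fderiv]
    rw [add_apply, smul_apply, smul_apply, hp]
    simp only [smul_eq_mul, Derivation.leibniz,
      MvPolynomial.pderiv_X, polyFun, EuclideanSpace.basisFun_apply, PiLp.proj_apply,
      PiLp.single_apply, map_add, map_mul, MvPolynomial.eval_X, Pi.single_apply]
    by_cases hij : j = i
    · subst hij; simp
    · simp [hij]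

theorem fderiv_fderiv_apply {E : Type*} [NormedAddCommGroup E] [NormedSpace ℝ E] {f : E → ℝ}
    {x : E} (hf : ContDiffAt ℝ 2 f x) (v w : E) :
    fderiv ℝ (fderiv ℝ f) x v w = fderiv ℝ (fun y => fderiv ℝ f y w) x v := by
  have hd : DifferentiableAt ℝ (fderiv ℝ f) x :=
    (hf.fderiv_right (m := 1) (by norm_num)).differentiableAt (by simp)
  rw [fderiv_clm_apply hd (differentiableAt_const w)]
  simp

theorem laplacian_polyFun {m : ℕ} (p : MvPolynomial (Fin m) ℝ) (x : EuclideanSpace ℝ (Fin m)) :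
    Δ (polyFun p) x = polyFun (polyLaplacian m p) x := by
  rw [laplacian_eq_sum (EuclideanSpace.basisFun (Fin m) ℝ), polyLaplacian_apply]
  simp only [polyFun, map_sum]
  refine Finset.sum_congr rfl fun i _ => ?_
  change fderiv ℝ (fderiv ℝ (polyFun p)) x _ _ = _
  rw [fderiv_fderiv_apply (contDiff_polyFun p).contDiffAt]
  simp only [fderiv_polyFun]
  rfl

theorem totalDegree_pderiv_le {m : ℕ} (p : MvPolynomial (Fin m) ℝ) (i : Fin m) :
    (MvPolynomial.pderiv i p).totalDegree ≤ p.totalDegree - 1 := by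
  conv_lhs => rw [p.as_sum, map_sum]
  refine MvPolynomial.totalDegree_finsetSum_le fun s hs => ?_
  rw [MvPolynomial.pderiv_monomial]
  by_cases hsi : s i = 0
  · simp [hsi]
  · refine (MvPolynomial.totalDegree_monomial_le _ _).trans ?_
    have h1 : s.degree ≤ p.totalDegree := by
      exact MvPolynomial.le_totalDegree hs
    have h2 : (s - Finsupp.single i 1) + Finsupp.single i 1 = s := by
      refine tsub_add_cancel_of_le ?_
      simpa using Nat.one_le_iff_ne_zero.2 hsi
    have h3 := congrArg Finsupp.degree h2
    rw [map_add, Finsupp.degree_single] at h3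
    change (s - Finsupp.single i 1).degree ≤ _
    omega

theorem totalDegree_polyLaplacian_le {m : ℕ} (p : MvPolynomial (Fin m) ℝ) :
    (polyLaplacian m p).totalDegree ≤ p.totalDegree - 2 := by
  rw [polyLaplacian_apply]
  refine MvPolynomial.totalDegree_finsetSum_le fun i _ => ?_
  have h1 := totalDegree_pderiv_le p i
  have h2 := totalDegree_pderiv_le (MvPolynomial.pderiv i p) i
  omega

/-- The polynomial `|x - a|²`. -/
noncomputable def polyDistSq {m : ℕ} (a : EuclideanSpace ℝ (Fin m)) : MvPolynomial (Fin m) ℝ :=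
  ∑ i, (MvPolynomial.X i - MvPolynomial.C (a i)) ^ 2

theorem polyFun_polyDistSq {m : ℕ} (a x : EuclideanSpace ℝ (Fin m)) :
    polyFun (polyDistSq a) x = dist x a ^ 2 := by
  rw [dist_eq_norm, EuclideanSpace.norm_sq_eq]
  simp [polyFun, polyDistSq]

theorem totalDegree_polyDistSq_le {m : ℕ} (a : EuclideanSpace ℝ (Fin m)) :
    (polyDistSq a).totalDegree ≤ 2 := by
  refine MvPolynomial.totalDegree_finsetSum_le fun i _ => ?_
  refine (MvPolynomial.totalDegree_pow _ _).trans ?_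
  have h := MvPolynomial.totalDegree_sub_C_le (MvPolynomial.X (R := ℝ) i) (a i)
  rw [MvPolynomial.totalDegree_X] at h
  omega

theorem polyLaplacian_polyDistSq {m : ℕ} (a : EuclideanSpace ℝ (Fin m)) :
    polyLaplacian m (polyDistSq a) = MvPolynomial.C (2 * m : ℝ) := by
  rw [polyLaplacian_apply]
  have h : ∀ i, MvPolynomial.pderiv i (MvPolynomial.pderiv i (polyDistSq a)) =
      MvPolynomial.C 2 := by
    intro i
    have h1 : MvPolynomial.pderiv i (polyDistSq a) =
        2 * (MvPolynomial.X i - MvPolynomial.C (a i)) := by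
      rw [polyDistSq, map_sum, Finset.sum_eq_single i]
      · simp [Derivation.leibniz_pow]
      · intro j _ hj
        simp [Derivation.leibniz_pow, MvPolynomial.pderiv_X_of_ne hj]
      · simp
    rw [h1, show (2 : MvPolynomial (Fin m) ℝ) = MvPolynomial.C 2 from (map_ofNat _ 2).symm,
      MvPolynomial.pderiv_C_mul]
    simp
  rw [Finset.sum_congr rfl fun i _ => h i]
  simp [mul_comm]

/-! ### Comparison with smooth functions -/

/-- Comparison principle: at an interior maximum of `u - h` the strict differential inequality for
`h` would contradict the definition of a viscosity subsolution. -/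
theorem IsViscositySubsolutionOn.sub_le_of_lt {m : ℕ} {κ ρ C : ℝ}
    {u h : EuclideanSpace ℝ (Fin m) → ℝ} {x₀ : EuclideanSpace ℝ (Fin m)}
    (hsub : IsViscositySubsolutionOn κ u (ball x₀ ρ)) (hu : ContinuousOn u (closedBall x₀ ρ))
    (hh : ContDiff ℝ 2 h) (hlt : ∀ x ∈ ball x₀ ρ, Δ h x < κ * u x)
    (hC : ∀ x ∈ sphere x₀ ρ, u x - h x ≤ C) {x : EuclideanSpace ℝ (Fin m)}
    (hx : x ∈ closedBall x₀ ρ) : u x - h x ≤ C := by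
  obtain ⟨z, hz, hmax⟩ := (isCompact_closedBall x₀ ρ).exists_isMaxOn ⟨x, hx⟩
    (hu.sub hh.continuous.continuousOn)
  refine (hmax hx).trans ?_
  rcases (mem_closedBall.1 hz).lt_or_eq with hlt' | heq
  · have hzb : z ∈ ball x₀ ρ := hlt'
    have hloc : IsLocalMax (fun y => u y - h y) z :=
      (hmax.on_subset ball_subset_closedBall).isLocalMax (isOpen_ball.mem_nhds hzb)
    exact absurd (hsub z hzb h hh.contDiffAt hloc) (not_le.2 (hlt z hzb))
  · exact hC z heq

/-- Quantitative comparison: a defect `ε` in the differential inequality is absorbed by the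
barrier `ε |x - x₀|²`, whose Laplacian is `2mε > ε`. -/
theorem IsViscositySubsolutionOn.sub_le_of_le {m : ℕ} (hm : 1 ≤ m) {κ ρ C ε : ℝ} (hε : 0 < ε)
    {u h : EuclideanSpace ℝ (Fin m) → ℝ} {x₀ : EuclideanSpace ℝ (Fin m)}
    (hsub : IsViscositySubsolutionOn κ u (ball x₀ ρ)) (hu : ContinuousOn u (closedBall x₀ ρ))
    (hh : ContDiff ℝ 2 h) (hle : ∀ x ∈ ball x₀ ρ, Δ h x ≤ κ * u x + ε)
    (hC : ∀ x ∈ sphere x₀ ρ, u x - h x ≤ C) {x : EuclideanSpace ℝ (Fin m)}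
    (hx : x ∈ closedBall x₀ ρ) : u x - h x ≤ C + ε * ρ ^ 2 := by
  have hm1 : (1 : ℝ) ≤ m := by exact_mod_cast hm
  set b := polyFun (polyDistSq x₀) with hb
  have hbd : ContDiff ℝ 2 b := contDiff_polyFun _
  have hΔ : ∀ y, Δ (h - ε • b) y = Δ h y - ε * (2 * m) := by
    intro y
    rw [ContDiffAt.laplacian_sub hh.contDiffAt (f₂ := ε • b) (hbd.const_smul ε).contDiffAt,
      InnerProductSpace.laplacian_smul ε hbd.contDiffAt, hb, laplacian_polyFun,
      polyLaplacian_polyDistSq]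
    simp [polyFun]
  have key := hsub.sub_le_of_lt (h := h - ε • b) (C := C + ε * ρ ^ 2) hu
    (hh.sub (hbd.const_smul ε)) (fun y hy => ?_) (fun y hy => ?_) hx
  · have hb0 : 0 ≤ ε * b x := by rw [hb, polyFun_polyDistSq]; positivity
    simp only [Pi.sub_apply, Pi.smul_apply, smul_eq_mul] at key
    linarith
  · rw [hΔ]
    have := hle y hy
    nlinarith
  · have hby : b y = ρ ^ 2 := by rw [hb, polyFun_polyDistSq, mem_sphere.1 hy]
    simp only [Pi.sub_apply, Pi.smul_apply, smul_eq_mul, hby]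
    linarith [hC y hy]

/-- The classical necessary condition `Δ g ≥ 0` at a local minimum of `g`. -/
theorem isViscositySubsolutionOn_zero {m : ℕ} (hm : 1 ≤ m)
    (D : Set (EuclideanSpace ℝ (Fin m))) : IsViscositySubsolutionOn 0 0 D := by
  intro x _ g hg hmax
  refine (isIsotropic_ballMeasure hm).le_laplacian_of_isLocalMax (u := 0) (a := fun _ => 1)
    (by positivity) ?_ hg ?_ ?_ hmax
  · exact Eventually.of_forall fun y => continuousAt_const
  · simp
  · simp

/-! ### The Dirichlet problem with polynomial data -/

/-- The polynomial `ρ² - |x - a|²`, which vanishes on the sphere of radius `ρ` about `a`. -/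
noncomputable def polySphere {m : ℕ} (a : EuclideanSpace ℝ (Fin m)) (ρ : ℝ) :
    MvPolynomial (Fin m) ℝ :=
  MvPolynomial.C (ρ ^ 2) - polyDistSq a

theorem polyFun_polySphere {m : ℕ} (a x : EuclideanSpace ℝ (Fin m)) (ρ : ℝ) :
    polyFun (polySphere a ρ) x = ρ ^ 2 - dist x a ^ 2 := by
  rw [← polyFun_polyDistSq]
  simp [polyFun, polySphere]

theorem polyFun_mul {m : ℕ} (p q : MvPolynomial (Fin m) ℝ) (x : EuclideanSpace ℝ (Fin m)) :
    polyFun (p * q) x = polyFun p x * polyFun q x := by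
  simp [polyFun]

theorem eq_zero_of_polyFun_eq_zero {m : ℕ} {a : EuclideanSpace ℝ (Fin m)} {ρ : ℝ} (hρ : 0 < ρ)
    {q : MvPolynomial (Fin m) ℝ} (hq : ∀ x ∈ ball a ρ, polyFun q x = 0) : q = 0 := by
  have hopen : IsOpen ((WithLp.toLp 2 : (Fin m → ℝ) → EuclideanSpace ℝ (Fin m)) ⁻¹' ball a ρ) :=
    isOpen_ball.preimage (PiLp.continuous_toLp 2 _)
  obtain ⟨δ, hδ, hsub⟩ := Metric.isOpen_iff.1 hopen a.ofLp (by simpa using hρ)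
  refine MvPolynomial.funext_set (fun i => ball (a i) δ) (fun i => ?_) fun x hx => ?_
  · rw [Real.ball_eq_Ioo]
    exact Ioo_infinite (by linarith)
  · rw [map_zero]
    refine hq (WithLp.toLp 2 x) (hsub ?_)
    rw [ball_pi _ hδ]
    exact hx

/-- By the maximum principle, a polynomial that vanishes on a sphere is determined by its
Laplacian. -/
theorem eq_zero_of_polyLaplacian_polySphere_mul {m : ℕ} (hm : 1 ≤ m)
    {a : EuclideanSpace ℝ (Fin m)} {ρ : ℝ} (hρ : 0 < ρ) {q : MvPolynomial (Fin m) ℝ}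
    (hq : polyLaplacian m (polySphere a ρ * q) = 0) : q = 0 := by
  have hneg : ∀ r : MvPolynomial (Fin m) ℝ, polyLaplacian m (polySphere a ρ * r) = 0 →
      ∀ x ∈ ball a ρ, 0 ≤ polyFun (polySphere a ρ * r) x := by
    intro r hr x hx
    refine le_of_forall_pos_le_add fun ε hε => ?_
    have h := (isViscositySubsolutionOn_zero hm (ball a ρ)).sub_le_of_le hm (C := 0)
      (ε := ε / ρ ^ 2) (h := polyFun (polySphere a ρ * r)) (by positivity) continuousOn_const
      (contDiff_polyFun _) (fun y _ => ?_) (fun y hy => ?_) (ball_subset_closedBall hx)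
    · rw [div_mul_cancel₀ _ (by positivity)] at h
      simp only [Pi.zero_apply] at h
      linarith
    · rw [laplacian_polyFun, hr]
      simp only [polyFun, map_zero, zero_mul, zero_add]
      positivity
    · rw [polyFun_mul, polyFun_polySphere, mem_sphere.1 hy]
      simp
  refine eq_zero_of_polyFun_eq_zero (a := a) hρ fun x hx => ?_
  have h1 := hneg q hq x hx
  have h2 := hneg (-q) (by rw [mul_neg, map_neg, hq, neg_zero]) x hx
  have h3 : polyFun (polySphere a ρ * -q) x = -polyFun (polySphere a ρ * q) x := by
    simp [polyFun]
  have h4 : polyFun (polySphere a ρ * q) x = 0 := by linarith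
  rw [polyFun_mul, polyFun_polySphere] at h4
  have h5 : 0 < ρ ^ 2 - dist x a ^ 2 := by
    have := mem_ball.1 hx
    nlinarith [dist_nonneg (x := x) (y := a)]
  exact (mul_eq_zero.1 h4).resolve_left h5.ne'

/-- The map `q ↦ Δ((ρ² - |x - a|²) q)` preserves the finite-dimensional space of polynomials of
degree at most `n`; being injective, it is surjective. -/
theorem exists_polyLaplacian_polySphere_mul_eq {m : ℕ} (hm : 1 ≤ m)
    (a : EuclideanSpace ℝ (Fin m)) {ρ : ℝ} (hρ : 0 < ρ) (f : MvPolynomial (Fin m) ℝ) :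
    ∃ q, polyLaplacian m (polySphere a ρ * q) = f := by
  set V := MvPolynomial.restrictTotalDegree (Fin m) ℝ f.totalDegree
  let T : MvPolynomial (Fin m) ℝ →ₗ[ℝ] MvPolynomial (Fin m) ℝ :=
    polyLaplacian m ∘ₗ LinearMap.mulLeft ℝ (polySphere a ρ)
  have hT : ∀ q ∈ V, T q ∈ V := by
    intro q hq
    rw [MvPolynomial.mem_restrictTotalDegree] at hq ⊢
    have h1 : (polySphere a ρ).totalDegree ≤ 2 := by
      refine (MvPolynomial.totalDegree_sub _ _).trans ?_
      rw [MvPolynomial.totalDegree_C]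
      exact max_le (Nat.zero_le _) (totalDegree_polyDistSq_le a)
    have h2 := MvPolynomial.totalDegree_mul (polySphere a ρ) q
    have h3 := totalDegree_polyLaplacian_le (polySphere a ρ * q)
    have h4 : T q = polyLaplacian m (polySphere a ρ * q) := rfl
    rw [h4]
    omega
  have hinj : Function.Injective (T.restrict hT) := by
    rw [injective_iff_map_eq_zero]
    intro q hq
    exact Subtype.ext (eq_zero_of_polyLaplacian_polySphere_mul hm hρ (congrArg Subtype.val hq))
  obtain ⟨q, hq⟩ := (LinearMap.injective_iff_surjective.1 hinj)
    ⟨f, by rw [MvPolynomial.mem_restrictTotalDegree]⟩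
  exact ⟨q, congrArg Subtype.val hq⟩

/-- Solution of the Dirichlet problem for the Poisson equation in a ball, for polynomial data. -/
theorem exists_polynomial_dirichlet {m : ℕ} (hm : 1 ≤ m) (a : EuclideanSpace ℝ (Fin m)) {ρ : ℝ}
    (hρ : 0 < ρ) (p f : MvPolynomial (Fin m) ℝ) :
    ∃ h : MvPolynomial (Fin m) ℝ, polyLaplacian m h = f ∧
      ∀ x ∈ sphere a ρ, polyFun h x = polyFun p x := by
  obtain ⟨q, hq⟩ := exists_polyLaplacian_polySphere_mul_eq hm a hρ (f - polyLaplacian m p)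
  refine ⟨p + polySphere a ρ * q, by rw [map_add, hq]; abel, fun x hx => ?_⟩
  have h : polyFun (p + polySphere a ρ * q) x = polyFun p x + polyFun (polySphere a ρ * q) x := by
    simp [polyFun]
  rw [h, polyFun_mul, polyFun_polySphere, mem_sphere.1 hx]
  simp

/-! ### Approximation of viscosity solutions by polynomials -/

/-- Weierstrass approximation in several variables. -/
theorem exists_polyFun_near {m : ℕ} {K : Set (EuclideanSpace ℝ (Fin m))} (hK : IsCompact K)
    {u : EuclideanSpace ℝ (Fin m) → ℝ} (hu : ContinuousOn u K) {ε : ℝ} (hε : 0 < ε) :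
    ∃ p : MvPolynomial (Fin m) ℝ, ∀ x ∈ K, |polyFun p x - u x| ≤ ε := by
  have : CompactSpace K := isCompact_iff_compactSpace.1 hK
  let coord : Fin m → C(K, ℝ) := fun i => ⟨fun x => (x : EuclideanSpace ℝ (Fin m)) i, by fun_prop⟩
  let Φ : MvPolynomial (Fin m) ℝ →ₐ[ℝ] C(K, ℝ) := MvPolynomial.aeval coord
  have hΦ : ∀ p (x : K), Φ p x = polyFun p x := by
    intro p x
    induction p using MvPolynomial.induction_on with
    | C a => simp [Φ, polyFun]
    | add p q hp hq => simp only [map_add, ContinuousMap.add_apply, hp, hq]; simp [polyFun]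
    | mul_X p i hp => simp only [map_mul, ContinuousMap.mul_apply, hp]; simp [polyFun, Φ, coord]
  have hsep : Φ.range.SeparatesPoints := by
    intro x y hxy
    have : ∃ i, (x : EuclideanSpace ℝ (Fin m)) i ≠ (y : EuclideanSpace ℝ (Fin m)) i := by
      by_contra! h
      exact hxy (Subtype.ext (PiLp.ext h))
    obtain ⟨i, hi⟩ := this
    refine ⟨_, ⟨Φ (MvPolynomial.X i), ⟨_, rfl⟩, rfl⟩, ?_⟩
    simpa [Φ, coord] using hi
  obtain ⟨⟨g, p, rfl⟩, hg⟩ :=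
    ContinuousMap.exists_mem_subalgebra_near_continuousMap_of_separatesPoints Φ.range hsep
      ⟨K.domRestrict u, hu.domRestrict⟩ ε hε
  refine ⟨p, fun x hx => ?_⟩
  have h := (ContinuousMap.norm_coe_le_norm _ (⟨x, hx⟩ : K)).trans hg.le
  change ‖Φ p ⟨x, hx⟩ - u x‖ ≤ ε at h
  rwa [hΦ] at h

/-- In a ball, a viscosity solution of `Δ u = κ u` continuous up to the boundary is a uniform limit
of polynomials `h` whose defect `Δ h - κ h` tends to zero uniformly. If `p` is a polynomial close
to `u`, one takes for `h` the solution of `Δ h = κ p` with boundary values `p`. -/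
theorem IsViscositySolutionOn.exists_polyFun_near {m : ℕ} (hm : 1 ≤ m) {κ ρ : ℝ} (hκ : 0 ≤ κ)
    (hρ : 0 < ρ) {u : EuclideanSpace ℝ (Fin m) → ℝ} {x₀ : EuclideanSpace ℝ (Fin m)}
    (hsol : IsViscositySolutionOn κ u (ball x₀ ρ)) (hu : ContinuousOn u (closedBall x₀ ρ))
    {ε : ℝ} (hε : 0 < ε) :
    ∃ h : MvPolynomial (Fin m) ℝ, ∀ x ∈ closedBall x₀ ρ,
      |polyFun h x - u x| ≤ ε ∧ |Δ (polyFun h) x - κ * polyFun h x| ≤ ε := by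
  -- `A * δ` dominates both errors produced by a `δ`-approximation `p` of `u`
  set A : ℝ := (1 + κ) * (2 + (κ + 1) * ρ ^ 2) with hA
  have hA0 : 0 < A := by positivity
  set δ := ε / A with hδ
  have hδ0 : 0 < δ := by positivity
  obtain ⟨p, hp⟩ := Panharmonic.exists_polyFun_near (isCompact_closedBall x₀ ρ) hu hδ0
  obtain ⟨h, hΔ, hbd⟩ := exists_polynomial_dirichlet hm x₀ hρ p (κ • p)
  have hlap : ∀ x, Δ (polyFun h) x = κ * polyFun p x := by
    intro x
    rw [laplacian_polyFun, hΔ]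
    simp [polyFun]
  have hup : ∀ x ∈ closedBall x₀ ρ, u x - polyFun h x ≤ δ + (κ + 1) * δ * ρ ^ 2 := by
    intro x hx
    refine hsol.1.sub_le_of_le hm (by positivity) hu (contDiff_polyFun h) (fun y hy => ?_)
      (fun y hy => ?_) hx
    · rw [hlap]
      have := (abs_le.1 (hp y (ball_subset_closedBall hy))).2
      nlinarith
    · rw [hbd y hy]
      linarith [(abs_le.1 (hp y (sphere_subset_closedBall hy))).1]
  have hlow : ∀ x ∈ closedBall x₀ ρ, -u x - -polyFun h x ≤ δ + (κ + 1) * δ * ρ ^ 2 := by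
    intro x hx
    refine hsol.2.sub_le_of_le (u := -u) (h := -polyFun h) hm (by positivity) hu.neg
      (contDiff_polyFun h).neg (fun y hy => ?_) (fun y hy => ?_) hx
    · rw [InnerProductSpace.laplacian_neg, Pi.neg_apply, Pi.neg_apply, hlap]
      have := (abs_le.1 (hp y (ball_subset_closedBall hy))).1
      nlinarith
    · rw [Pi.neg_apply, Pi.neg_apply, hbd y hy]
      linarith [(abs_le.1 (hp y (sphere_subset_closedBall hy))).2]
  have hAδ : A * δ = ε := by rw [hδ]; field_simp
  refine ⟨h, fun x hx => ?_⟩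
  have h1 : |polyFun h x - u x| ≤ δ + (κ + 1) * δ * ρ ^ 2 :=
    abs_le.2 ⟨by linarith [hup x hx], by linarith [hlow x hx]⟩
  have hsplit : A * δ = (1 + κ) * (δ + (δ + (κ + 1) * δ * ρ ^ 2)) := by rw [hA]; ring
  have hpos : 0 ≤ (κ + 1) * δ * ρ ^ 2 := by positivity
  refine ⟨h1.trans ?_, ?_⟩
  · rw [← hAδ, hsplit]; nlinarith
  · have h2 : |polyFun p x - polyFun h x| ≤ δ + (δ + (κ + 1) * δ * ρ ^ 2) := by
      have h3 := abs_le.1 (hp x hx)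
      have h4 := abs_le.1 h1
      exact abs_le.2 ⟨by linarith, by linarith⟩
    rw [hlap, ← mul_sub, abs_mul, abs_of_nonneg hκ, ← hAδ, hsplit]
    nlinarith [abs_nonneg (polyFun p x - polyFun h x)]

/-! ### Smoothness of uniform limits of almost harmonic functions -/

section Regularity

open scoped ContDiff RealInnerProductSpace

variable {V : Type*} [NormedAddCommGroup V] [InnerProductSpace ℝ V] [FiniteDimensional ℝ V]
  [MeasurableSpace V] [BorelSpace V]

/-- There is a radial mollifier `φ`, supported in the ball of radius `δ`, such that `φ(y) y` is
the gradient of a compactly supported function `g`. Here `g(y) = χ(|y|²)` and `φ(y) = 2 χ'(|y|²)`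
for a decreasing smooth cutoff `χ`; the integral of `φ` is negative. -/
theorem exists_radial_kernel [Nontrivial V] {δ : ℝ} (hδ : 0 < δ) :
    ∃ g φ : V → ℝ, ContDiff ℝ ∞ g ∧ ContDiff ℝ ∞ φ ∧
      (∀ y ∉ closedBall (0 : V) δ, g y = 0) ∧ (∀ y ∉ closedBall (0 : V) δ, φ y = 0) ∧
      (∀ y v, fderiv ℝ g y v = φ y * ⟪y, v⟫) ∧ ∫ y, φ y ≠ 0 := by
  set χ : ℝ → ℝ := fun t => Real.smoothTransition (1 - t / δ ^ 2) with hχ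
  have hχs : ContDiff ℝ ∞ χ := Real.smoothTransition.contDiff.comp (by fun_prop)
  have hχ' : ContDiff ℝ ∞ (deriv χ) := hχs.deriv'
  have hns : ContDiff ℝ ∞ fun y : V => ‖y‖ ^ 2 := contDiff_norm_sq ℝ
  have hzero : ∀ t, δ ^ 2 ≤ t → χ t = 0 := fun t ht =>
    Real.smoothTransition.zero_of_nonpos (by rw [sub_nonpos, le_div_iff₀ (by positivity)]; linarith)
  have hanti : Antitone χ := fun s t hst => Real.smoothTransition.monotone (by gcongr)
  set g : V → ℝ := fun y => χ (‖y‖ ^ 2) with hg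
  set φ : V → ℝ := fun y => 2 * deriv χ (‖y‖ ^ 2) with hφ
  have hgs : ContDiff ℝ ∞ g := hχs.comp hns
  have hφs : ContDiff ℝ ∞ φ := contDiff_const.mul (hχ'.comp hns)
  have hφ0 : ∀ y ∉ closedBall (0 : V) δ, φ y = 0 := by
    intro y hy
    have hy' : δ < ‖y‖ := by simpa using hy
    have hlt : δ ^ 2 < ‖y‖ ^ 2 := by gcongr
    have : χ =ᶠ[𝓝 (‖y‖ ^ 2)] fun _ => 0 := by
      filter_upwards [Ioi_mem_nhds hlt] with t ht using hzero t (le_of_lt ht)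
    simp [hφ, this.deriv_eq]
  have hfd : ∀ y v, fderiv ℝ g y v = φ y * ⟪y, v⟫ := by
    intro y v
    have h1 : HasDerivAt χ (deriv χ (‖y‖ ^ 2)) (‖y‖ ^ 2) :=
      (hχs.differentiable (by simp) _).hasDerivAt
    have h2 := h1.comp_hasFDerivAt y (hasStrictFDerivAt_norm_sq y).hasFDerivAt
    have h3 : HasFDerivAt g _ y := h2
    rw [h3.fderiv]
    simp [hφ]
    ring
  refine ⟨g, φ, hgs, hφs, fun y hy => ?_, hφ0, hfd, ?_⟩
  · have hy' : δ < ‖y‖ := by simpa using hy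
    exact hzero _ (by gcongr)
  · -- `φ` is not identically zero, since otherwise `g` would be constant
    have hne : φ ≠ 0 := by
      intro h
      have hconst : ∀ y, fderiv ℝ g y = 0 := fun y => by
        ext v; rw [hfd, h]; simp
      obtain ⟨y, hy⟩ := exists_norm_eq V (by positivity : 0 ≤ 2 * δ)
      have := is_const_of_fderiv_eq_zero (hgs.differentiable (by simp)) hconst y 0
      simp only [hg, hy, norm_zero] at this
      rw [hzero _ (by nlinarith)] at this
      simp [hχ] at this
    have hpos := Continuous.integral_pos_of_hasCompactSupport_nonneg_nonzero
      (μ := (volume : Measure V)) (f := fun y => -φ y) hφs.continuous.neg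
      (HasCompactSupport.intro (isCompact_closedBall (0 : V) δ) fun y hy => by simp [hφ0 y hy])
      (fun y => ?_) (x := (Function.ne_iff.1 hne).choose) ?_
    · rw [integral_neg] at hpos
      linarith
    · have : deriv χ (‖y‖ ^ 2) ≤ 0 := hanti.deriv_nonpos
      simp only [hφ, Pi.zero_apply]
      linarith
    · simpa using (Function.ne_iff.1 hne).choose_spec

variable {g φ : V → ℝ} {δ : ℝ}

/-- Derivative of the mollification with respect to the scale: since `φ(y) y = ∇g(y)`, an
integration by parts turns it into an integral of the Laplacian. -/
theorem hasDerivAt_integral_radial (hg : ContDiff ℝ ∞ g) (hφ : ContDiff ℝ ∞ φ)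
    (hg0 : ∀ y ∉ closedBall (0 : V) δ, g y = 0) (hφ0 : ∀ y ∉ closedBall (0 : V) δ, φ y = 0)
    (hgφ : ∀ y v, fderiv ℝ g y v = φ y * ⟪y, v⟫) {W : V → ℝ} (hW : ContDiff ℝ 2 W) (z : V)
    (s : ℝ) :
    HasDerivAt (fun s : ℝ => ∫ y, W (z - s • y) * φ y)
      (-∫ y, s * Δ W (z - s • y) * g y) s := by
  have hgc : HasCompactSupport g := HasCompactSupport.intro (isCompact_closedBall (0 : V) δ) hg0
  have hφc : HasCompactSupport φ := HasCompactSupport.intro (isCompact_closedBall (0 : V) δ) hφ0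
  have hWd : Differentiable ℝ W := hW.differentiable (by simp)
  have hW' : ContDiff ℝ 1 (fderiv ℝ W) := hW.fderiv_right (by norm_num)
  have hW'c : Continuous (fderiv ℝ W) := hW'.continuous
  have hWc := hW.continuous
  have hφcont := hφ.continuous
  have hgcont := hg.continuous
  set b := stdOrthonormalBasis ℝ V
  have hline : ∀ (y : V) (t : ℝ), HasDerivAt (fun t : ℝ => W (z - t • y) * φ y)
      (-(fderiv ℝ W (z - t • y) y * φ y)) t := by
    intro y t
    have h1 : HasDerivAt (fun t : ℝ => z - t • y) (-y) t := by
      simpa using ((hasDerivAt_id t).smul_const y).const_sub z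
    have h2 := ((hWd (z - t • y)).hasFDerivAt.comp_hasDerivAt t h1).mul_const (φ y)
    simpa using h2
  obtain ⟨M, hM⟩ : ∃ M, ∀ q ∈ closedBall s 1 ×ˢ closedBall (0 : V) δ,
      ‖fderiv ℝ W (z - q.1 • q.2) q.2‖ ≤ M := by
    refine ((isCompact_closedBall s 1).prod (isCompact_closedBall (0 : V) δ))
      |>.exists_bound_of_continuousOn ?_
    exact Continuous.continuousOn (by fun_prop)
  have key := (hasDerivAt_integral_of_dominated_loc_of_deriv_le (μ := (volume : Measure V))
    (F := fun t y => W (z - t • y) * φ y)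
    (F' := fun t y => -(fderiv ℝ W (z - t • y) y * φ y))
    (bound := fun y => M * ‖φ y‖) (x₀ := s) (s := closedBall s 1)
    (closedBall_mem_nhds s one_pos) (Eventually.of_forall fun t => ?_) ?_ ?_ (ae_of_all _ ?_) ?_
    (ae_of_all _ fun y t _ => hline y t)).2
  · refine key.congr_deriv ?_
    rw [integral_neg, neg_inj]
    have hexp : ∀ y, fderiv ℝ W (z - s • y) y * φ y =
        ∑ i, fderiv ℝ W (z - s • y) (b i) * fderiv ℝ g y (b i) := by
      intro y
      conv_lhs => rw [← b.sum_repr' y, map_sum, Finset.sum_mul]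
      refine Finset.sum_congr rfl fun i _ => ?_
      rw [hgφ, map_smul, smul_eq_mul, b.sum_repr' y, real_inner_comm]
      ring
    have hDg : ∀ v, HasCompactSupport fun y => fderiv ℝ g y v := fun v =>
      hgc.fderiv_apply ℝ v
    have hDgc : Continuous (fderiv ℝ g) := hg.continuous_fderiv (by simp)
    have hi1 : ∀ i, Integrable (fun y => fderiv ℝ W (z - s • y) (b i) * fderiv ℝ g y (b i))
        (volume : Measure V) := fun i =>
      Continuous.integrable_of_hasCompactSupport (by fun_prop) ((hDg (b i)).mul_left)
    have hcomp : ∀ i y, HasFDerivAt (fun y => fderiv ℝ W (z - s • y) (b i))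
        ((((ContinuousLinearMap.apply ℝ ℝ (b i)).comp (fderiv ℝ (fderiv ℝ W) (z - s • y)))).comp
          (-(s • ContinuousLinearMap.id ℝ V))) y := by
      intro i y
      have h1 : HasFDerivAt (fun y : V => z - s • y) (-(s • ContinuousLinearMap.id ℝ V)) y :=
        ((hasFDerivAt_id y).const_smul s).const_sub z
      have h2 := (hW'.differentiable one_ne_zero (z - s • y)).hasFDerivAt
      exact ((ContinuousLinearMap.apply ℝ ℝ (b i)).hasFDerivAt.comp _ h2).comp y h1
    have hfd : ∀ i y, fderiv ℝ (fun y => fderiv ℝ W (z - s • y) (b i)) y (b i) =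
        -(s * fderiv ℝ (fderiv ℝ W) (z - s • y) (b i) (b i)) := by
      intro i y
      rw [(hcomp i y).fderiv]
      simp
    have hW''c : Continuous (fderiv ℝ (fderiv ℝ W)) := hW'.continuous_fderiv one_ne_zero
    have hi2 : ∀ i, Integrable (fun y => s * fderiv ℝ (fderiv ℝ W) (z - s • y) (b i) (b i) * g y)
        (volume : Measure V) := fun i =>
      Continuous.integrable_of_hasCompactSupport (by fun_prop) hgc.mul_left
    have hibp : ∀ i, ∫ y, fderiv ℝ W (z - s • y) (b i) * fderiv ℝ g y (b i) =
        ∫ y, s * fderiv ℝ (fderiv ℝ W) (z - s • y) (b i) (b i) * g y := by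
      intro i
      rw [integral_mul_fderiv_eq_neg_fderiv_mul_of_integrable
        (f := fun y => fderiv ℝ W (z - s • y) (b i)) ?_ (hi1 i) ?_
        (fun y _ => (hcomp i y).differentiableAt) (fun y _ => hg.differentiable (by simp) y)]
      · simp only [hfd, neg_mul, integral_neg, neg_neg]
      · simp only [hfd, neg_mul]
        exact (hi2 i).neg
      · exact Continuous.integrable_of_hasCompactSupport (by fun_prop) hgc.mul_left
    rw [integral_congr_ae (ae_of_all _ hexp), integral_finsetSum _ fun i _ => hi1 i,
      Finset.sum_congr rfl fun i _ => hibp i, ← integral_finsetSum _ fun i _ => hi2 i]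
    refine integral_congr_ae (ae_of_all _ fun y => ?_)
    simp only [laplacian_eq_sum b, Finset.mul_sum, Finset.sum_mul]
  · exact Continuous.aestronglyMeasurable (by fun_prop)
  · exact Continuous.integrable_of_hasCompactSupport (by fun_prop) hφc.mul_left
  · exact Continuous.aestronglyMeasurable (by fun_prop)
  · intro y t ht
    by_cases hy : y ∈ closedBall (0 : V) δ
    · rw [norm_neg, norm_mul]
      exact mul_le_mul_of_nonneg_right (hM (t, y) ⟨ht, hy⟩) (norm_nonneg _)
    · simp [hφ0 y hy]
  · exact ((hφcont.integrable_of_hasCompactSupport hφc).norm).const_mul M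

/-- Approximate mean value property of functions with small Laplacian. -/
theorem abs_integral_radial_sub_le (hg : ContDiff ℝ ∞ g) (hφ : ContDiff ℝ ∞ φ)
    (hg0 : ∀ y ∉ closedBall (0 : V) δ, g y = 0) (hφ0 : ∀ y ∉ closedBall (0 : V) δ, φ y = 0)
    (hgφ : ∀ y v, fderiv ℝ g y v = φ y * ⟪y, v⟫) {W : V → ℝ} (hW : ContDiff ℝ 2 W) (z : V)
    {ε : ℝ} (hε : ∀ y ∈ closedBall z δ, |Δ W y| ≤ ε) :
    |(∫ y, W (z - y) * φ y) - W z * ∫ y, φ y| ≤ ε * ∫ y, |g y| := by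
  have hgc : HasCompactSupport g := HasCompactSupport.intro (isCompact_closedBall (0 : V) δ) hg0
  have hgi : Integrable g (volume : Measure V) :=
    hg.continuous.integrable_of_hasCompactSupport hgc
  have hder := hasDerivAt_integral_radial hg hφ hg0 hφ0 hgφ hW z
  have key := norm_image_sub_le_of_norm_deriv_le_segment_01'
    (f := fun s : ℝ => ∫ y, W (z - s • y) * φ y) (C := ε * ∫ y, |g y|)
    (fun s _ => (hder s).hasDerivWithinAt) fun s hs => ?_
  · simpa [integral_const_mul] using key
  · rw [norm_neg, ← integral_const_mul]
    refine norm_integral_le_of_norm_le (hgi.abs.const_mul ε) (ae_of_all _ fun y => ?_)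
    by_cases hy : y ∈ closedBall (0 : V) δ
    · have hs0 := hs.1
      have hs1 := hs.2.le
      have hyn : ‖y‖ ≤ δ := by simpa using hy
      have hmem : z - s • y ∈ closedBall z δ := by
        rw [mem_closedBall, dist_eq_norm, sub_sub_cancel_left, norm_neg, norm_smul,
          Real.norm_of_nonneg hs0]
        nlinarith [norm_nonneg y]
      rw [norm_mul, norm_mul, Real.norm_of_nonneg hs0, Real.norm_eq_abs, Real.norm_eq_abs]
      refine mul_le_mul_of_nonneg_right ?_ (abs_nonneg _)
      exact (mul_le_of_le_one_left (abs_nonneg _) hs1).trans (hε _ hmem)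
    · simp [hg0 y hy]

/-- A Weyl type lemma: a uniform limit of `C²` functions whose Laplacians tend to zero uniformly
is smooth, because it agrees with a multiple of its mollification. -/
theorem contDiffAt_of_approx [Nontrivial V] {U : V → ℝ} {z₀ : V} {ρ : ℝ} (hρ : 0 < ρ)
    (hU : ContinuousOn U (closedBall z₀ ρ))
    (happ : ∀ ε > 0, ∃ W : V → ℝ, ContDiff ℝ 2 W ∧
      ∀ z ∈ closedBall z₀ ρ, |W z - U z| ≤ ε ∧ |Δ W z| ≤ ε) :
    ContDiffAt ℝ ∞ U z₀ := by
  obtain ⟨g, φ, hg, hφ, hg0, hφ0, hgφ, hne⟩ := exists_radial_kernel (V := V) (half_pos hρ)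
  have hφc : HasCompactSupport φ :=
    HasCompactSupport.intro (isCompact_closedBall (0 : V) (ρ / 2)) hφ0
  have hφi : Integrable φ (volume : Measure V) := hφ.continuous.integrable_of_hasCompactSupport hφc
  set Uc : V → ℝ := (closedBall z₀ ρ).indicator U with hUc
  have hUi : LocallyIntegrable Uc (volume : Measure V) :=
    ((hU.integrableOn_compact (isCompact_closedBall _ _)).integrable_indicator
      measurableSet_closedBall).locallyIntegrable
  have hsmooth := hφc.contDiff_convolution_left (n := ⊤) (ContinuousLinearMap.mul ℝ ℝ) hφ hUi
  have heq : ∀ z ∈ ball z₀ (ρ / 2),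
      (convolution φ Uc (ContinuousLinearMap.mul ℝ ℝ) volume) z = U z * ∫ y, φ y := by
    intro z hz
    have hzmem : z ∈ closedBall z₀ ρ := by
      rw [mem_closedBall]; linarith [mem_ball.1 hz]
    have hmem : ∀ y ∈ closedBall (0 : V) (ρ / 2), z - y ∈ closedBall z₀ ρ := by
      intro y hy
      have h1 : dist (z - y) z ≤ ρ / 2 := by simpa [dist_eq_norm] using hy
      rw [mem_closedBall]
      linarith [dist_triangle (z - y) z z₀, mem_ball.1 hz]
    have hconv : (convolution φ Uc (ContinuousLinearMap.mul ℝ ℝ) volume) z =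
        ∫ y, U (z - y) * φ y := by
      refine integral_congr_ae (ae_of_all _ fun y => ?_)
      by_cases hy : y ∈ closedBall (0 : V) (ρ / 2)
      · simp only [ContinuousLinearMap.mul_apply', hUc, indicator_of_mem (hmem y hy)]
        ring
      · simp [hφ0 y hy]
    have hUint : Integrable (fun y => U (z - y) * φ y) (volume : Measure V) := by
      rw [← integrableOn_iff_integrable_of_support_subset (s := closedBall (0 : V) (ρ / 2))]
      · refine ContinuousOn.integrableOn_compact (isCompact_closedBall _ _) ?_
        have hshift : Continuous fun y : V => z - y := by fun_prop
        exact (hU.comp hshift.continuousOn hmem).mul hφ.continuous.continuousOn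
      · intro y hy
        by_contra hcon
        exact hy (by simp [hφ0 y hcon])
    rw [hconv, ← sub_eq_zero, ← abs_eq_zero]
    refine le_antisymm (le_of_forall_pos_le_add fun η hη => ?_) (abs_nonneg _)
    have hφQ : 0 ≤ ∫ y, |φ y| := integral_nonneg fun y => abs_nonneg _
    have hgQ : 0 ≤ ∫ y, |g y| := integral_nonneg fun y => abs_nonneg _
    set P := ∫ y, |φ y|
    set Q := ∫ y, |g y|
    obtain ⟨W, hW, hWU⟩ := happ (η / (2 * P + Q + 1)) (by positivity)
    set ε := η / (2 * P + Q + 1) with hε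
    have hε0 : 0 < ε := by positivity
    have hsub : closedBall z (ρ / 2) ⊆ closedBall z₀ ρ := fun y hy => by
      rw [mem_closedBall] at hy ⊢
      linarith [dist_triangle y z z₀, mem_ball.1 hz]
    have hWint : Integrable (fun y => W (z - y) * φ y) (volume : Measure V) := by
      have := hW.continuous
      have := hφ.continuous
      exact Continuous.integrable_of_hasCompactSupport (by fun_prop) hφc.mul_left
    have h1 : |(∫ y, U (z - y) * φ y) - ∫ y, W (z - y) * φ y| ≤ ε * P := by
      rw [← integral_sub hUint hWint, ← integral_const_mul, ← Real.norm_eq_abs]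
      refine norm_integral_le_of_norm_le (hφi.abs.const_mul ε) (ae_of_all _ fun y => ?_)
      by_cases hy : y ∈ closedBall (0 : V) (ρ / 2)
      · rw [← sub_mul, norm_mul, Real.norm_eq_abs, Real.norm_eq_abs, abs_sub_comm]
        exact mul_le_mul_of_nonneg_right (hWU _ (hmem y hy)).1 (abs_nonneg _)
      · simp [hφ0 y hy]
    have h2 := abs_integral_radial_sub_le hg hφ hg0 hφ0 hgφ hW z
      (fun y hy => (hWU y (hsub hy)).2)
    have h3 : |W z * (∫ y, φ y) - U z * ∫ y, φ y| ≤ ε * P := by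
      rw [← sub_mul, abs_mul]
      exact mul_le_mul (hWU z hzmem).1 (abs_integral_le_integral_abs) (abs_nonneg _) hε0.le
    have h4 : ε * (2 * P + Q + 1) = η := by rw [hε]; field_simp
    have h5 := abs_sub_le (∫ y, U (z - y) * φ y) (∫ y, W (z - y) * φ y) (U z * ∫ y, φ y)
    have h6 := abs_sub_le (∫ y, W (z - y) * φ y) (W z * ∫ y, φ y) (U z * ∫ y, φ y)
    nlinarith
  have hloc : U =ᶠ[𝓝 z₀] fun z =>
      (convolution φ Uc (ContinuousLinearMap.mul ℝ ℝ) volume) z / ∫ y, φ y := by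
    filter_upwards [ball_mem_nhds z₀ (half_pos hρ)] with z hz
    rw [heq z hz, mul_div_cancel_right₀ _ hne]
  have hquot : ContDiff ℝ ∞ fun z =>
      (convolution φ Uc (ContinuousLinearMap.mul ℝ ℝ) volume) z / ∫ y, φ y :=
    ContDiff.div_const hsmooth _
  exact hquot.contDiffAt.congr_of_eventuallyEq hloc

end Regularity

/-! ### The harmonic lift `u(x) cos(μ t)` -/

section Lift

open scoped ContDiff

variable {m : ℕ}

/-- The projection `(t, x) ↦ x` of `ℝ^{m+1}` onto `ℝ^m`; the first coordinate is `t`. -/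
noncomputable def dropFirst (m : ℕ) :
    EuclideanSpace ℝ (Fin (m + 1)) →L[ℝ] EuclideanSpace ℝ (Fin m) :=
  (PiLp.continuousLinearEquiv 2 ℝ fun _ : Fin m => ℝ).symm.toContinuousLinearMap ∘L
    ContinuousLinearMap.pi fun i : Fin m =>
      (EuclideanSpace.proj i.succ : EuclideanSpace ℝ (Fin (m + 1)) →L[ℝ] ℝ)

@[simp]
theorem dropFirst_apply (z : EuclideanSpace ℝ (Fin (m + 1))) (i : Fin m) :
    dropFirst m z i = z i.succ := rfl

/-- The inclusion `x ↦ (0, x)` of `ℝ^m` into `ℝ^{m+1}`. -/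
noncomputable def consZero (x : EuclideanSpace ℝ (Fin m)) : EuclideanSpace ℝ (Fin (m + 1)) :=
  WithLp.toLp 2 (Fin.cons 0 x.ofLp)

theorem dropFirst_consZero (x : EuclideanSpace ℝ (Fin m)) : dropFirst m (consZero x) = x := by
  ext i; simp [consZero]

theorem contDiff_consZero {n : WithTop ℕ∞} :
    ContDiff ℝ n (consZero : EuclideanSpace ℝ (Fin m) → EuclideanSpace ℝ (Fin (m + 1))) := by
  rw [contDiff_euclidean]
  intro i
  refine Fin.cases ?_ (fun j => ?_) i
  · exact contDiff_const
  · exact contDiff_euclidean.1 contDiff_id j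

theorem norm_dropFirst_le (z : EuclideanSpace ℝ (Fin (m + 1))) : ‖dropFirst m z‖ ≤ ‖z‖ := by
  refine le_of_sq_le_sq ?_ (norm_nonneg z)
  rw [EuclideanSpace.norm_sq_eq, EuclideanSpace.norm_sq_eq, Fin.sum_univ_succ]
  simp only [dropFirst_apply]
  linarith [sq_nonneg ‖z 0‖]

theorem dropFirst_basisFun_zero : dropFirst m (EuclideanSpace.basisFun (Fin (m + 1)) ℝ 0) = 0 := by
  ext i; simp

theorem dropFirst_basisFun_succ (i : Fin m) :
    dropFirst m (EuclideanSpace.basisFun (Fin (m + 1)) ℝ i.succ) =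
      EuclideanSpace.basisFun (Fin m) ℝ i := by
  ext j; simp

/-- The function `(t, x) ↦ k(x) f(t)` on `ℝ^{m+1}`. -/
noncomputable def liftProd (k : EuclideanSpace ℝ (Fin m) → ℝ) (f : ℝ → ℝ)
    (z : EuclideanSpace ℝ (Fin (m + 1))) : ℝ :=
  k (dropFirst m z) * f (z 0)

theorem contDiff_liftProd {k : EuclideanSpace ℝ (Fin m) → ℝ} {f : ℝ → ℝ} {n : WithTop ℕ∞}
    (hk : ContDiff ℝ n k) (hf : ContDiff ℝ n f) : ContDiff ℝ n (liftProd k f) :=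
  (hk.comp (dropFirst m).contDiff).mul (hf.comp (contDiff_euclidean.1 contDiff_id 0))

theorem fderiv_liftProd {k : EuclideanSpace ℝ (Fin m) → ℝ} {f : ℝ → ℝ}
    (hk : Differentiable ℝ k) (hf : Differentiable ℝ f) (z w : EuclideanSpace ℝ (Fin (m + 1))) :
    fderiv ℝ (liftProd k f) z w =
      fderiv ℝ k (dropFirst m z) (dropFirst m w) * f (z 0) +
        k (dropFirst m z) * (deriv f (z 0) * w 0) := by
  have h1 := (hk (dropFirst m z)).hasFDerivAt.comp z (dropFirst m).hasFDerivAt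
  have h2 := (hf (z 0)).hasDerivAt.comp_hasFDerivAt z
    (EuclideanSpace.proj 0 : EuclideanSpace ℝ (Fin (m + 1)) →L[ℝ] ℝ).hasFDerivAt
  have h3 : HasFDerivAt (liftProd k f) _ z := h1.mul h2
  rw [h3.fderiv]
  simp
  ring

theorem laplacian_liftProd {k : EuclideanSpace ℝ (Fin m) → ℝ} {f : ℝ → ℝ} (hk : ContDiff ℝ 2 k)
    (hf : ContDiff ℝ 2 f) (z : EuclideanSpace ℝ (Fin (m + 1))) :
    Δ (liftProd k f) z =
      Δ k (dropFirst m z) * f (z 0) + k (dropFirst m z) * deriv (deriv f) (z 0) := by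
  have hkd : Differentiable ℝ k := hk.differentiable (by simp)
  have hfd : Differentiable ℝ f := hf.differentiable (by simp)
  have hf' : Differentiable ℝ (deriv f) :=
    ((contDiff_succ_iff_deriv (n := 1)).1 hf).2.2.differentiable one_ne_zero
  have hk' : ContDiff ℝ 1 (fderiv ℝ k) := hk.fderiv_right (by norm_num)
  rw [laplacian_eq_sum (EuclideanSpace.basisFun (Fin (m + 1)) ℝ), Fin.sum_univ_succ,
    laplacian_eq_sum (EuclideanSpace.basisFun (Fin m) ℝ), Finset.sum_mul, add_comm]
  congr 1
  · refine Finset.sum_congr rfl fun i _ => ?_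
    set e := EuclideanSpace.basisFun (Fin m) ℝ i
    have hfirst : (fun y => fderiv ℝ (liftProd k f) y
        (EuclideanSpace.basisFun (Fin (m + 1)) ℝ i.succ)) = liftProd (fun x => fderiv ℝ k x e) f := by
      ext y
      rw [fderiv_liftProd hkd hfd, dropFirst_basisFun_succ]
      simp [liftProd, e]
    rw [fderiv_fderiv_apply (contDiff_liftProd hk hf).contDiffAt, hfirst,
      fderiv_liftProd (hk'.clm_apply contDiff_const |>.differentiable one_ne_zero) hfd,
      dropFirst_basisFun_succ, fderiv_fderiv_apply hk.contDiffAt]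
    simp [e]
  · have hfirst : (fun y => fderiv ℝ (liftProd k f) y (EuclideanSpace.basisFun (Fin (m + 1)) ℝ 0)) =
        liftProd k (deriv f) := by
      ext y
      rw [fderiv_liftProd hkd hfd, dropFirst_basisFun_zero]
      simp [liftProd]
    rw [fderiv_fderiv_apply (contDiff_liftProd hk hf).contDiffAt, hfirst, fderiv_liftProd hkd hf',
      dropFirst_basisFun_zero]
    simp

theorem laplacian_liftProd_cos {k : EuclideanSpace ℝ (Fin m) → ℝ} (hk : ContDiff ℝ 2 k) (μ : ℝ)
    (z : EuclideanSpace ℝ (Fin (m + 1))) :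
    Δ (liftProd k fun t => Real.cos (μ * t)) z =
      (Δ k (dropFirst m z) - μ ^ 2 * k (dropFirst m z)) * Real.cos (μ * z 0) := by
  have hlin : ∀ t : ℝ, HasDerivAt (fun t : ℝ => μ * t) μ t := fun t => by
    simpa using (hasDerivAt_id t).const_mul μ
  have h1 : deriv (fun t => Real.cos (μ * t)) = fun t => -Real.sin (μ * t) * μ := by
    ext t; exact (hlin t).cos.deriv
  have h2 : ∀ t, deriv (fun t => -Real.sin (μ * t) * μ) t = -(Real.cos (μ * t) * μ) * μ :=
    fun t => ((hlin t).sin.neg.mul_const μ).deriv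
  rw [laplacian_liftProd hk (by fun_prop), h1, h2]
  ring

end Lift

/-! ### Regularity of viscosity solutions -/

/-- Continuous viscosity solutions of `Δ u = μ² u` are smooth: their lifts `u(x) cos(μ t)` are
uniform limits of almost harmonic functions. -/
theorem IsViscositySolutionOn.contDiffAt {m : ℕ} (hm : 1 ≤ m)
    {D : Set (EuclideanSpace ℝ (Fin m))} (hD : IsOpen D) {μ : ℝ}
    {u : EuclideanSpace ℝ (Fin m) → ℝ} (hu : ContinuousOn u D)
    (hsol : IsViscositySolutionOn (μ ^ 2) u D) {x₀ : EuclideanSpace ℝ (Fin m)} (hx₀ : x₀ ∈ D) :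
    ContDiffAt ℝ 2 u x₀ := by
  obtain ⟨ρ, hρ, hball⟩ := Metric.nhds_basis_closedBall.mem_iff.1 (hD.mem_nhds hx₀)
  have hsolρ : IsViscositySolutionOn (μ ^ 2) u (ball x₀ ρ) :=
    ⟨fun x hx => hsol.1 x (hball (ball_subset_closedBall hx)),
      fun x hx => hsol.2 x (hball (ball_subset_closedBall hx))⟩
  set f : ℝ → ℝ := fun t => Real.cos (μ * t)
  have hmaps : MapsTo (dropFirst m) (closedBall (consZero x₀) ρ) (closedBall x₀ ρ) := by
    intro z hz
    rw [mem_closedBall, dist_eq_norm] at hz ⊢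
    rw [← dropFirst_consZero x₀, ← map_sub]
    exact (norm_dropFirst_le _).trans hz
  have hU : ContinuousOn (liftProd u f) (closedBall (consZero x₀) ρ) :=
    ((hu.mono hball).comp (dropFirst m).continuous.continuousOn hmaps).mul
      (Continuous.continuousOn (by fun_prop))
  have hsmooth := contDiffAt_of_approx hρ hU fun ε hε => by
    obtain ⟨h, hh⟩ := hsolρ.exists_polyFun_near hm (sq_nonneg μ) hρ (hu.mono hball) hε
    refine ⟨liftProd (polyFun h) f, contDiff_liftProd (contDiff_polyFun h) (by fun_prop), fun z hz => ?_⟩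
    obtain ⟨h1, h2⟩ := hh _ (hmaps hz)
    have hcos : |f (z 0)| ≤ 1 := Real.abs_cos_le_one _
    constructor
    · rw [liftProd, liftProd, ← sub_mul, abs_mul]
      exact (mul_le_of_le_one_right (abs_nonneg _) hcos).trans h1
    · rw [laplacian_liftProd_cos (contDiff_polyFun h), abs_mul]
      exact (mul_le_of_le_one_right (abs_nonneg _) hcos).trans h2
  have hrestrict : u = liftProd u f ∘ consZero := by
    ext x
    have h0 : consZero x 0 = 0 := rfl
    rw [Function.comp_apply, liftProd, dropFirst_consZero, h0]
    simp [f]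
  rw [hrestrict]
  exact (hsmooth.of_le (by norm_cast)).comp x₀ contDiff_consZero.contDiffAt

/-- Once `u` is known to be of class `C²`, it may serve as its own test function. -/
theorem IsViscositySolutionOn.isPanharmonicOn {m : ℕ} (hm : 1 ≤ m)
    {D : Set (EuclideanSpace ℝ (Fin m))} (hD : IsOpen D) {μ : ℝ}
    {u : EuclideanSpace ℝ (Fin m) → ℝ} (hu : ContinuousOn u D)
    (hsol : IsViscositySolutionOn (μ ^ 2) u D) : IsPanharmonicOn μ u D := by
  refine ⟨fun x hx => (hsol.contDiffAt hm hD hu hx).contDiffWithinAt, fun x hx => ?_⟩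
  have hux := hsol.contDiffAt hm hD hu hx
  have h1 := hsol.1 x hx u hux (by simp [IsLocalMax, IsMaxFilter])
  have h2 := hsol.2 x hx (-u) hux.neg (by simp [IsLocalMax, IsMaxFilter])
  rw [InnerProductSpace.laplacian_neg, Pi.neg_apply, Pi.neg_apply] at h2
  linarith

end Panharmonic

theorem theorem3p1 (m : ℕ) (hm : 1 ≤ m) (D : Set (EuclideanSpace ℝ (Fin m)))
    (hD : Panharmonic.IsDomainSet D) (hDb : Bornology.IsBounded D) (μ : ℝ) (hμ : 0 < μ)
    (u : EuclideanSpace ℝ (Fin m) → ℝ) (hu : ContinuousOn u D) :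
    ((∀ x ∈ D, ∃ R : ℝ, Panharmonic.Admissible D x R ∧ ∀ r ∈ Set.Ioo 0 R,
        Panharmonic.sphericalMean u x r = Panharmonic.sphericalCoeff m (μ * r) * u x) →
      Panharmonic.IsPanharmonicOn μ u D) ∧
    ((∀ x ∈ D, ∃ R : ℝ, Panharmonic.Admissible D x R ∧ ∀ r ∈ Set.Ioo 0 R,
        Panharmonic.volumeMean u x r = Panharmonic.volumeCoeff m (μ * r) * u x) →
      Panharmonic.IsPanharmonicOn μ u D) :=
  ⟨fun h => (Panharmonic.isViscositySolutionOn_of_sphericalMean hm hD.1 hμ hu h).isPanharmonicOn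
      hm hD.1 hu,
    fun h => (Panharmonic.isViscositySolutionOn_of_volumeMean hm hD.1 hμ hu h).isPanharmonicOn
      hm hD.1 hu⟩
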